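/- Let $\lambda\in\mathbb R$, let $I\subseteq\mathbb R$ be open, and let $m,q:I\to\mathbb R$ be smooth. Consider the Vaidya–Bonner–de Sitter (VBdS) metric $$g=\Bigl(1-\tfrac{2m(t)}{r}+\tfrac{q(t)^2}{r^2}-\tfrac{\lambda r^2}{3}\Bigr)dt^2-2\,dt\,dr-r^2(d\theta^2+\sin^2\theta\,d\phi^2)$$ in coordinates $(x^1,x^2,x^3,x^4)=(t,r,\theta,\phi)$, on the region $U$ where $t\in I$, $r>0$, $0<\theta<\pi$ and $q(t)^2-r\,m(t)\neq0$. Conventions. Let $n=4$, let $\nabla$ be the Levi-Civita connection with Christoffel symbols $\Gamma^k_{ij}$, and put $R_{efst}=g_{ea}(\partial_s\Gamma^a_{ft}-\partial_t\Gamma^a_{fs}+\Gamma^b_{ft}\Gamma^a_{bs}-\Gamma^b_{fs}\Gamma^a_{bt})$, $S_{fs}=g^{et}R_{efst}$, $\bar\kappa=g^{fs}S_{fs}$ (so that $\bar\kappa=4\lambda$), $S^d_{e}=g^{da}S_{ae}$, $S^1=S$, $S^k_{ij}=S^a_{i}\,S^{k-1}_{aj}$ for $k\ge 2$, $$(A\wedge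 B)_{efst}=A_{et}B_{fs}-A_{es}B_{ft}+A_{fs}B_{et}-A_{ft}B_{es},$$ $$har(R)=R-\tfrac1{n-2}\,g\wedge S,\qquad cir(R)=R-\tfrac{\bar\kappa}{2n(n-1)}\,g\wedge g,\qquad C=R-\tfrac1{n-2}\,g\wedge S+\tfrac{\bar\kappa}{2(n-1)(n-2)}\,g\wedge g,$$ $$P_{efst}=R_{efst}-\tfrac1{n-1}(g_{et}S_{fs}-g_{ft}S_{es}).$$ For $(0,4)$-tensors $L,W$ and a symmetric $(0,2)$-tensor $B$, with $L^a{}_{brs}=g^{ae}L_{ebrs}$, put $$(L\cdot W)_{b_1b_2b_3b_4rs}=-\bigl[L^a{}_{b_1rs}W_{ab_2b_3b_4}+\dots+L^a{}_{b_4rs}W_{b_1b_2b_3a}\bigr],$$ $$Q(B,W)_{b_1b_2b_3b_4rs}=B_{sb_1}W_{rb_2b_3b_4}+\dots+B_{sb_4}W_{b_1b_2b_3r}-B_{rb_1}W_{sb_2b_3b_4}-\dots-B_{rb_4}W_{b_1b_2b_3s}.$$ Theorem. On $U$ the following hold. 1. $C\cdot C=-\frac{rm-q^2}{r^4}\,Q(g,C)$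 and $C\cdot har(R)=-\frac{rm-q^2}{r^4}\,Q(g,har(R))$. 2. $har(R)\cdot C=-\frac{2r^4\lambda+3rm-3q^2}{3r^4}\,Q(g,C)$ and $har(R)\cdot har(R)=-\frac{2r^4\lambda+3rm-3q^2}{3r^4}\,Q(g,har(R))$. 3. $R\cdot R+\beta\,Q(g,C)=Q(S,R)$ with $\beta=\frac{2r^5\lambda m+3r^2m^2-2r^4\lambda q^2-6rmq^2+2q^4}{3r^4(rm-q^2)}$. 4. The conformal $2$-forms are recurrent for the $1$-form with components $\Pi=\bigl(\frac{rm'-(q^2)'}{rm-q^2},\ \frac{q^2}{r^2m-rq^2},\ 0,\ 0\bigr)$, that is, $\nabla_eC_{fstd}+\nabla_fC_{setd}+\nabla_sC_{eftd}=\Pi_eC_{fstd}+\Pi_fC_{setd}+\Pi_sC_{eftd}$. 5. On the part of $U$ where $q(t)\neq0$ the spacetime is of generalized Roter type: there are smooth functions $c_{ij}$ with $R=c_{11}\,g\wedge g+c_{12}\,g\wedge S+c_{22}\,S\wedge S+c_{13}\,g\wedge S^2+c_{23}\,S\wedge S^2+c_{33}\,S^2\wedge S^2$. On all of $U$ it is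 Ein$(3)$: there are smooth functions $c_0,\dots,c_3$ on $U$ without common zero such that $c_0\,g+c_1S+c_2S^2+c_3S^3=0$. 6. The Ricci tensor is compatible with each $T\in\{R,P,cir(R),har(R),C\}$: $S^d_eT_{fstd}+S^d_fT_{setd}+S^d_sT_{eftd}=0$. -/

import Mathlib

open scoped ContDiff

namespace SemiRiemannian

/-- Points of a coordinate domain of dimension `n`. -/
abbrev Pt (n : ℕ) := Fin n → ℝ

/-- The components of a covector field in the coordinates. -/
abbrev Cov1 (n : ℕ) := Pt n → Fin n → ℝ

/-- The components of a (0,2) tensor field in the coordinates. -/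
abbrev Cov2 (n : ℕ) := Pt n → Fin n → Fin n → ℝ

/-- The components of a (0,4) tensor field in the coordinates. -/
abbrev Cov4 (n : ℕ) := Pt n → Fin n → Fin n → Fin n → Fin n → ℝ

/-- A (0,6) tensor field; the last two indices are the ones of the operator pair. -/
abbrev Cov6 (n : ℕ) := Pt n → Fin n → Fin n → Fin n → Fin n → Fin n → Fin n → ℝ

section General

variable {n : ℕ}

/-- The partial derivative of `f` in the `i`-th coordinate. -/
noncomputable def pd (i : Fin n) (f : Pt n → ℝ) (x : Pt n) : ℝ :=
  deriv (fun s : ℝ => f (Function.update x i s)) (x i)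

/-- The inverse metric, with components `g^{ij}`. -/
noncomputable def inverseMetric (g : Cov2 n) (x : Pt n) : Matrix (Fin n) (Fin n) ℝ :=
  (Matrix.of (g x))⁻¹

/-- The Christoffel symbol `Γ^k_{ij}` of the second kind. -/
noncomputable def christoffel (g : Cov2 n) (k i j : Fin n) (x : Pt n) : ℝ :=
  (1 / 2) * ∑ l, inverseMetric g x k l *
    (pd i (fun y => g y l j) x + pd j (fun y => g y i l) x - pd l (fun y => g y i j) x)

/-- The Riemann-Christoffel tensor of type (0,4),
`R_{efst} = g_{ea} (∂_s Γ^a_{ft} - ∂_t Γ^a_{fs} + Γ^b_{ft} Γ^a_{bs} - Γ^b_{fs} Γ^a_{bt})`. -/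
noncomputable def riemann (g : Cov2 n) : Cov4 n := fun x e f s t =>
  ∑ a, g x e a * (pd s (christoffel g a f t) x - pd t (christoffel g a f s) x
    + ∑ b, (christoffel g b f t x * christoffel g a b s x
      - christoffel g b f s x * christoffel g a b t x))

/-- The Ricci tensor, as the contraction `S_{fs} = g^{et} R_{efst}`. -/
noncomputable def ricci (g : Cov2 n) : Cov2 n := fun x f s =>
  ∑ e, ∑ t, inverseMetric g x e t * riemann g x e f s t

/-- The scalar curvature `g^{fs} S_{fs}`. -/
noncomputable def scalarCurv (g : Cov2 n) (x : Pt n) : ℝ :=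
  ∑ f, ∑ s, inverseMetric g x f s * ricci g x f s

/-- The Ricci operator of type (1,1), `J^d_e = g^{da} S_{ae}`. -/
noncomputable def ricciOp (g : Cov2 n) (x : Pt n) (d e : Fin n) : ℝ :=
  ∑ a, inverseMetric g x d a * ricci g x a e

/-- The powers of the Ricci tensor: `S^0 = g`, `S^1 = S`, `S^k(X, Y) = S^{k-1}(JX, Y)`. -/
noncomputable def ricciPow (g : Cov2 n) : ℕ → Cov2 n
  | 0 => g
  | 1 => ricci g
  | k + 2 => fun x i j => ∑ a, ricciOp g x a i * ricciPow g (k + 1) x a j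

/-- The Kulkarni-Nomizu product. -/
def kulkarniNomizu (A B : Cov2 n) : Cov4 n := fun x e f s t =>
  A x e t * B x f s - A x e s * B x f t + A x f s * B x e t - A x f t * B x e s

/-- The conharmonic curvature tensor of type (0,4). -/
noncomputable def conharmonic (g : Cov2 n) : Cov4 n := fun x e f s t =>
  riemann g x e f s t - 1 / ((n : ℝ) - 2) * kulkarniNomizu g (ricci g) x e f s t

/-- The concircular curvature tensor of type (0,4). -/
noncomputable def concircular (g : Cov2 n) : Cov4 n := fun x e f s t =>
  riemann g x e f s t
    - scalarCurv g x / (2 * (n : ℝ) * ((n : ℝ) - 1)) * kulkarniNomizu g g x e f s t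

/-- The Weyl conformal curvature tensor of type (0,4). -/
noncomputable def weyl (g : Cov2 n) : Cov4 n := fun x e f s t =>
  riemann g x e f s t - 1 / ((n : ℝ) - 2) * kulkarniNomizu g (ricci g) x e f s t
    + scalarCurv g x / (2 * ((n : ℝ) - 1) * ((n : ℝ) - 2)) * kulkarniNomizu g g x e f s t

/-- The projective curvature tensor of type (0,4). -/
noncomputable def projective (g : Cov2 n) : Cov4 n := fun x e f s t =>
  riemann g x e f s t
    - 1 / ((n : ℝ) - 1) * (g x e t * ricci g x f s - g x f t * ricci g x e s)

/-- The (1,3) form of a (0,4) tensor: `L^a_{fst} = g^{ae} L_{efst}`. -/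
noncomputable def raiseFirst (g : Cov2 n) (L : Cov4 n) (x : Pt n) (a f s t : Fin n) : ℝ :=
  ∑ e, inverseMetric g x a e * L x e f s t

/-- The tensor `L · W` for (0,4) tensors `L`, `W`: the endomorphisms given by the last two indices
of `L` act on `W` as derivations,
`(L · W)_{bcdf rs} = -(L^a_{brs} W_{acdf} + L^a_{crs} W_{badf} + L^a_{drs} W_{bcaf}
+ L^a_{frs} W_{bcda})`. -/
noncomputable def curvDot (g : Cov2 n) (L W : Cov4 n) : Cov6 n := fun x b c d f r s =>
  -∑ a, (raiseFirst g L x a b r s * W x a c d f + raiseFirst g L x a c r s * W x b a d f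
    + raiseFirst g L x a d r s * W x b c a f + raiseFirst g L x a f r s * W x b c d a)

/-- The Tachibana tensor `Q(B, W)` of a (0,2) tensor `B` and a (0,4) tensor `W`. -/
def tachibana (B : Cov2 n) (W : Cov4 n) : Cov6 n := fun x b c d f r s =>
  B x s b * W x r c d f + B x s c * W x b r d f + B x s d * W x b c r f + B x s f * W x b c d r
    - B x r b * W x s c d f - B x r c * W x b s d f - B x r d * W x b c s f
    - B x r f * W x b c d s

/-- The covariant derivative `∇_e W_{fstd}` of a (0,4) tensor (Levi-Civita connection). -/
noncomputable def covDeriv (g : Cov2 n) (W : Cov4 n) (x : Pt n) (e f s t d : Fin n) : ℝ :=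
  pd e (fun y => W y f s t d) x
    - ∑ a, (christoffel g a e f x * W x a s t d + christoffel g a e s x * W x f a t d
      + christoffel g a e t x * W x f s a d + christoffel g a e d x * W x f s t a)

/-- The curvature 2-forms of the (0,4) tensor `W` are recurrent on `U` for the 1-form `P`: the cyclic
sums over `e, f, s` of `∇_e W_{fstd}` and of `P_e W_{fstd}` agree. -/
def TwoFormsRecurrentOn (g : Cov2 n) (W : Cov4 n) (P : Cov1 n) (U : Set (Pt n)) : Prop :=
  ∀ x ∈ U, ∀ e f s t d : Fin n,
    covDeriv g W x e f s t d + covDeriv g W x f s e t d + covDeriv g W x s e f t d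
      = P x e * W x f s t d + P x f * W x s e t d + P x s * W x e f t d

/-- The Ricci tensor is `W`-compatible on `U`: the cyclic sum over `e, f, s` of
`S^d_e W_{fstd}` vanishes. -/
def RicciCompatibleOn (g : Cov2 n) (W : Cov4 n) (U : Set (Pt n)) : Prop :=
  ∀ x ∈ U, ∀ e f s t : Fin n,
    ∑ d, (ricciOp g x d e * W x f s t d + ricciOp g x d f * W x s e t d
      + ricciOp g x d s * W x e f t d) = 0

/-- `g` is Ein(k) on `U`: the tensors `g, S, S^2, …, S^k` are linearly dependent at every point,
with coefficients that are smooth functions on `U` without common zero. -/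
def IsEinOn (g : Cov2 n) (k : ℕ) (U : Set (Pt n)) : Prop :=
  ∃ c : Fin (k + 1) → Pt n → ℝ, (∀ i, ContDiffOn ℝ ∞ (c i) U) ∧
    ∀ x ∈ U, (∃ i, c i x ≠ 0) ∧
      ∀ a b : Fin n, ∑ i : Fin (k + 1), c i x * ricciPow g i x a b = 0

/-- `g` is of generalized Roter type on `U`. -/
def IsGeneralizedRoterOn (g : Cov2 n) (U : Set (Pt n)) : Prop :=
  ∃ c₁₁ c₁₂ c₂₂ c₁₃ c₂₃ c₃₃ : Pt n → ℝ,
    ContDiffOn ℝ ∞ c₁₁ U ∧ ContDiffOn ℝ ∞ c₁₂ U ∧ ContDiffOn ℝ ∞ c₂₂ U ∧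
    ContDiffOn ℝ ∞ c₁₃ U ∧ ContDiffOn ℝ ∞ c₂₃ U ∧ ContDiffOn ℝ ∞ c₃₃ U ∧
    ∀ x ∈ U, ∀ e f s t : Fin n, riemann g x e f s t =
      c₁₁ x * kulkarniNomizu g g x e f s t
      + c₁₂ x * kulkarniNomizu g (ricci g) x e f s t
      + c₂₂ x * kulkarniNomizu (ricci g) (ricci g) x e f s t
      + c₁₃ x * kulkarniNomizu g (ricciPow g 2) x e f s t
      + c₂₃ x * kulkarniNomizu (ricci g) (ricciPow g 2) x e f s t
      + c₃₃ x * kulkarniNomizu (ricciPow g 2) (ricciPow g 2) x e f s t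

end General

/-- The Vaidya-Bonner-de Sitter metric
`(1 - 2m(t)/r + q(t)^2/r^2 - λ r^2/3) dt^2 - 2 dt dr - r^2 (dθ^2 + sin^2 θ dφ^2)`
in the coordinates `(x 0, x 1, x 2, x 3) = (t, r, θ, φ)`. -/
noncomputable def vbdsMetric (lam : ℝ) (m q : ℝ → ℝ) : Cov2 4 := fun x =>
  ![![1 - 2 * m (x 0) / x 1 + q (x 0) ^ 2 / x 1 ^ 2 - lam * x 1 ^ 2 / 3, -1, 0, 0],
    ![-1, 0, 0, 0],
    ![0, 0, -x 1 ^ 2, 0],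
    ![0, 0, 0, -(x 1 ^ 2 * Real.sin (x 2) ^ 2)]]

/-- The coordinate domain: `t ∈ I`, `r > 0`, `0 < θ < π`, with `q(t)^2 - r m(t) ≠ 0`. -/
def vbdsRegion (I : Set ℝ) (m q : ℝ → ℝ) : Set (Pt 4) :=
  {x | x 0 ∈ I ∧ 0 < x 1 ∧ 0 < x 2 ∧ x 2 < Real.pi ∧ q (x 0) ^ 2 - x 1 * m (x 0) ≠ 0}

/-- The function
`β = (2r^5 λ m + 3r^2 m^2 - 2r^4 λ q^2 - 6 r m q^2 + 2q^4) / (3r^4 (rm - q^2))`. -/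
noncomputable def vbdsBeta (lam : ℝ) (m q : ℝ → ℝ) (x : Pt 4) : ℝ :=
  (2 * x 1 ^ 5 * lam * m (x 0) + 3 * x 1 ^ 2 * m (x 0) ^ 2 - 2 * x 1 ^ 4 * lam * q (x 0) ^ 2
    - 6 * x 1 * m (x 0) * q (x 0) ^ 2 + 2 * q (x 0) ^ 4)
    / (3 * x 1 ^ 4 * (x 1 * m (x 0) - q (x 0) ^ 2))

/-- The 1-form `((r m' - (q^2)') / (rm - q^2), q^2 / (r^2 m - r q^2), 0, 0)`. -/
noncomputable def vbdsForm (m q : ℝ → ℝ) : Cov1 4 := fun x =>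
  ![(x 1 * deriv m (x 0) - deriv (fun t => q t ^ 2) (x 0)) / (x 1 * m (x 0) - q (x 0) ^ 2),
    q (x 0) ^ 2 / (x 1 ^ 2 * m (x 0) - x 1 * q (x 0) ^ 2), 0, 0]

end SemiRiemannian

open SemiRiemannian

open SemiRiemannian

/-! Write A for the coefficient of dt², g₁ = A dt² − 2 dt dr for the radial block and g₂ for the
angular block, so that g = g₁ + g₂ is a warped product of a surface with the round sphere. Put w =
(rm − q²)/r⁴, e = q²/r⁴ and φ = A_t/r. Everything rests on the decomposition R = (w − e/2 + λ/6)
g₁∧g₁ + (λ/3 − w) g₁∧g₂ + (w + e/2 + λ/6) g₂∧g₂ + (φ/2) g₂∧dt² (`riemann_vbdsMetric_eq`), whose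
contraction is S = (λ − e) g₁ + (λ + e) g₂ + φ dt². As dt is null, g₁∧dt² = 0, and the flux φ drops
out of C = w (g₁∧g₁ − g₁∧g₂ + g₂∧g₂) and of har(R) = C − (λ/3) g∧g.

Pseudosymmetry: C = (3w/2)(g₁∧g₁ + g₂∧g₂) − (w/2) g∧g. The operators of g₁∧g₁ and g₂∧g₂ are skew for
both blocks, so they annihilate every combination of gᵢ∧gⱼ; the operator of g∧g gives 2 Q(g, ·).
Hence C· acts as −w Q(g, ·), and har(R)· as −(w + 2λ/3) Q(g, ·) (`curvDot_twoBlock`).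

R·R: both R·W and Q(S, W) let endomorphisms act on W as derivations, so R·R − Q(S, R) is the action
of a single sparse family of endomorphisms on R. In components it is a multiple of Q(g, C) in which
φ cancels (`deriv4_splitOp_splitTensor`).

Recurrence: the cyclic sum of ∇ applied to C/w is (3/r) dr times C/w, cyclically summed, so Π = dw/w
+ 3 dr/r = d log |r³w| (`recurrent_weyl`).

Roter type and Ein(3): with a = λ − e and b = λ + e, the Ricci operator is a plus a nilpotent of
square zero on the radial plane and b on the angular plane. It is therefore annihilated by (X −
a)²(X − b), and (S − a)² is 4e² g₂. Where e ≠ 0 this puts g₂, then g₁ and φ dt², in the span of g,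
S, S² (`riemann_roter`).

Compatibility: for R it follows from the pattern of its nonzero components
(`ricciCompatible_riemann`); the other four tensors differ from R by terms in g and S whose cyclic
sums cancel (`ricciCompatible_add`). -/

namespace SemiRiemannian

/-! ### Reducing component checks by antisymmetry -/

theorem forall_fin_four {p : Fin 4 → Prop} : (∀ i, p i) ↔ p 0 ∧ p 1 ∧ p 2 ∧ p 3 := by
  simp [Fin.forall_fin_succ]

/-- Two antisymmetric functions of two indices agree once they agree on increasing pairs. -/
theorem antisymm_ext_four {F G : Fin 4 → Fin 4 → ℝ} (hF : ∀ i j, F i j = -F j i)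
    (hG : ∀ i j, G i j = -G j i) (h01 : F 0 1 = G 0 1) (h02 : F 0 2 = G 0 2)
    (h03 : F 0 3 = G 0 3) (h12 : F 1 2 = G 1 2) (h13 : F 1 3 = G 1 3) (h23 : F 2 3 = G 2 3)
    (i j : Fin 4) : F i j = G i j := by
  have hd : ∀ i, F i i = G i i := fun i => by linarith [hF i i, hG i i]
  revert i j
  simp only [forall_fin_four]
  refine ⟨⟨hd 0, h01, h02, h03⟩, ⟨?_, hd 1, h12, h13⟩, ⟨?_, ?_, hd 2, h23⟩, ⟨?_, ?_, ?_, hd 3⟩⟩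
  · rw [hF, hG, h01]
  · rw [hF, hG, h02]
  · rw [hF, hG, h12]
  · rw [hF, hG, h03]
  · rw [hF, hG, h13]
  · rw [hF, hG, h23]

/-- Two totally antisymmetric functions of three indices agree once they agree on increasing
triples. -/
theorem antisymm_ext_four_three {F G : Fin 4 → Fin 4 → Fin 4 → ℝ}
    (hF : ∀ i j k, F i j k = -F j i k) (hG : ∀ i j k, G i j k = -G j i k)
    (hF' : ∀ i j k, F i j k = F j k i) (hG' : ∀ i j k, G i j k = G j k i)
    (h012 : F 0 1 2 = G 0 1 2) (h013 : F 0 1 3 = G 0 1 3)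
    (h023 : F 0 2 3 = G 0 2 3) (h123 : F 1 2 3 = G 1 2 3) (i j k : Fin 4) :
    F i j k = G i j k := by
  have d1 : ∀ i k, F i i k = G i i k := fun i k => by linarith [hF i i k, hG i i k]
  have d2 : ∀ i k, F i k i = G i k i := fun i k => by rw [← hF', ← hG', d1]
  have s : ∀ i j k, F i j k = G i j k → F j i k = G j i k := fun i j k h => by
    rw [hF, hG, h]
  have c : ∀ i j k, F i j k = G i j k → F k i j = G k i j := fun i j k h => by
    rw [hF', hG', h]
  have hF2 : ∀ i j k, F i j k = -F i k j := fun i j k => by rw [hF', hF, ← hF' i k j]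
  have hG2 : ∀ i j k, G i j k = -G i k j := fun i j k => by rw [hG', hG, ← hG' i k j]
  have key : ∀ i, F i 0 1 = G i 0 1 → F i 0 2 = G i 0 2 → F i 0 3 = G i 0 3 →
      F i 1 2 = G i 1 2 → F i 1 3 = G i 1 3 → F i 2 3 = G i 2 3 → ∀ j k, F i j k = G i j k :=
    fun i => antisymm_ext_four (hF2 i) (hG2 i)
  revert i
  rw [forall_fin_four]
  exact ⟨key 0 (d1 _ _) (d1 _ _) (d1 _ _) h012 h013 h023 j k,
    key 1 (d2 _ _) (s _ _ _ h012) (s _ _ _ h013) (d1 _ _) (d1 _ _) h123 j k,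
    key 2 (c _ _ _ h012) (d2 _ _) (s _ _ _ h023) (d2 _ _) (s _ _ _ h123) (d1 _ _) j k,
    key 3 (c _ _ _ h013) (c _ _ _ h023) (d2 _ _) (c _ _ _ h123) (d2 _ _) (d2 _ _) j k⟩

/-! ### Endomorphisms acting on tensors as derivations -/

section Derivation

variable {n : ℕ}

/-- The endomorphism `M` acting on a (0,2) tensor as a derivation. -/
def deriv2 (M A : Fin n → Fin n → ℝ) (b c : Fin n) : ℝ :=
  ∑ a, (M a b * A a c + M a c * A b a)

/-- The endomorphism `M` acting on a (0,4) tensor as a derivation. -/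
def deriv4 (M : Fin n → Fin n → ℝ) (W : Fin n → Fin n → Fin n → Fin n → ℝ)
    (b c d f : Fin n) : ℝ :=
  ∑ a, (M a b * W a c d f + M a c * W b a d f + M a d * W b c a f + M a f * W b c d a)

theorem curvDot_eq_deriv4 (g : Cov2 n) (L W : Cov4 n) (x : Pt n) (b c d f r s : Fin n) :
    curvDot g L W x b c d f r s = -deriv4 (fun a b => raiseFirst g L x a b r s) (W x) b c d f :=
  rfl

/-- Together with `curvDot_eq_deriv4` this puts L·W and Q(B, W) in one form, so that they can be
added and compared at the level of endomorphisms. -/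
theorem tachibana_eq_deriv4 (B : Cov2 n) (W : Cov4 n) (x : Pt n) (b c d f r s : Fin n) :
    tachibana B W x b c d f r s
      = deriv4 (fun a b => (if a = r then B x s b else 0) - (if a = s then B x r b else 0))
          (W x) b c d f := by
  simp only [deriv4, sub_mul, ite_mul, zero_mul, Finset.sum_add_distrib, Finset.sum_sub_distrib,
    Finset.sum_ite_eq', Finset.mem_univ, if_true, tachibana]
  ring

theorem deriv4_add_left (M N : Fin n → Fin n → ℝ) (W : Fin n → Fin n → Fin n → Fin n → ℝ)
    (b c d f : Fin n) :
    deriv4 (fun a b => M a b + N a b) W b c d f = deriv4 M W b c d f + deriv4 N W b c d f := by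
  simp only [deriv4, ← Finset.sum_add_distrib]
  exact Finset.sum_congr rfl fun _ _ => by ring

theorem deriv4_smul_left (k : ℝ) (M : Fin n → Fin n → ℝ)
    (W : Fin n → Fin n → Fin n → Fin n → ℝ) (b c d f : Fin n) :
    deriv4 (fun a b => k * M a b) W b c d f = k * deriv4 M W b c d f := by
  simp only [deriv4, Finset.mul_sum]
  exact Finset.sum_congr rfl fun _ _ => by ring

theorem deriv4_add_right (M : Fin n → Fin n → ℝ) (V W : Fin n → Fin n → Fin n → Fin n → ℝ)
    (b c d f : Fin n) :
    deriv4 M (fun b c d f => V b c d f + W b c d f) b c d f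
      = deriv4 M V b c d f + deriv4 M W b c d f := by
  simp only [deriv4, ← Finset.sum_add_distrib]
  exact Finset.sum_congr rfl fun _ _ => by ring

theorem deriv4_smul_right (k : ℝ) (M : Fin n → Fin n → ℝ)
    (W : Fin n → Fin n → Fin n → Fin n → ℝ) (b c d f : Fin n) :
    deriv4 M (fun b c d f => k * W b c d f) b c d f = k * deriv4 M W b c d f := by
  simp only [deriv4, Finset.mul_sum]
  exact Finset.sum_congr rfl fun _ _ => by ring

/-- The Leibniz rule for the Kulkarni-Nomizu product. -/
theorem deriv4_kulkarniNomizu (M : Fin n → Fin n → ℝ) (A B : Cov2 n) (x : Pt n)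
    (b c d f : Fin n) :
    deriv4 M (kulkarniNomizu A B x) b c d f
      = kulkarniNomizu (fun _ => deriv2 M (A x)) B x b c d f
        + kulkarniNomizu A (fun _ => deriv2 M (B x)) x b c d f := by
  simp only [deriv4, kulkarniNomizu, deriv2, Finset.sum_mul, Finset.mul_sum,
    ← Finset.sum_add_distrib, ← Finset.sum_sub_distrib]
  exact Finset.sum_congr rfl fun _ _ => by ring

end Derivation

open Filter Topology

/-! ### Partial derivatives along coordinate lines -/

section PartialDerivative

variable {n : ℕ}

/-- Closed forms for the Christoffel symbols and the Weyl tensor are available only on an open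
chart. A partial derivative depends only on values near the point, so this is enough to
differentiate them. -/
theorem pd_congr {U : Set (Pt n)} (hU : IsOpen U) {f g : Pt n → ℝ} (h : Set.EqOn f g U)
    {x : Pt n} (hx : x ∈ U) (i : Fin n) : pd i f x = pd i g x := by
  refine Filter.EventuallyEq.deriv_eq ?_
  have hc : ContinuousAt (fun s : ℝ => Function.update x i s) (x i) := by fun_prop
  have hm : U ∈ 𝓝 (Function.update x i (x i)) := by
    rw [Function.update_eq_self]
    exact hU.mem_nhds hx
  filter_upwards [hc.preimage_mem_nhds hm] with s hs using h hs

theorem pd_const (i : Fin n) (c : ℝ) (x : Pt n) : pd i (fun _ => c) x = 0 := by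
  simp [pd]

theorem pd_neg (i : Fin n) (f : Pt n → ℝ) (x : Pt n) : pd i (fun y => -f y) x = -pd i f x := by
  simp [pd]

theorem pd_zero_eq {F : ℝ → ℝ → ℝ → ℝ} {x : Pt 4} {v : ℝ}
    (h : HasDerivAt (fun s => F s (x 1) (x 2)) v (x 0)) :
    pd 0 (fun y => F (y 0) (y 1) (y 2)) x = v := by
  simpa [pd] using h.deriv

theorem pd_one_eq {F : ℝ → ℝ → ℝ → ℝ} {x : Pt 4} {v : ℝ}
    (h : HasDerivAt (fun s => F (x 0) s (x 2)) v (x 1)) :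
    pd 1 (fun y => F (y 0) (y 1) (y 2)) x = v := by
  simpa [pd] using h.deriv

theorem pd_two_eq {F : ℝ → ℝ → ℝ → ℝ} {x : Pt 4} {v : ℝ}
    (h : HasDerivAt (fun s => F (x 0) (x 1) s) v (x 2)) :
    pd 2 (fun y => F (y 0) (y 1) (y 2)) x = v := by
  simpa [pd] using h.deriv

theorem pd_three_eq (F : ℝ → ℝ → ℝ → ℝ) (x : Pt 4) :
    pd 3 (fun y => F (y 0) (y 1) (y 2)) x = 0 := by
  simp [pd]

end PartialDerivative

/-! ### The chart and the coefficient of dt² -/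

/-- The domain on which the metric and the mass and charge functions are regular. -/
def vbdsChart (I : Set ℝ) : Set (Pt 4) := {x | x 0 ∈ I ∧ x 1 ≠ 0 ∧ Real.sin (x 2) ≠ 0}

theorem isOpen_vbdsChart {I : Set ℝ} (hI : IsOpen I) : IsOpen (vbdsChart I) := by
  refine (hI.preimage (continuous_apply 0)).inter (IsOpen.inter ?_ ?_)
  · exact isOpen_ne_fun (continuous_apply 1) continuous_const
  · exact isOpen_ne_fun (Real.continuous_sin.comp (continuous_apply 2)) continuous_const

/-- The coefficient of `dt^2`. -/
noncomputable def lapse (lam : ℝ) (m q : ℝ → ℝ) (t r : ℝ) : ℝ :=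
  1 - 2 * m t / r + q t ^ 2 / r ^ 2 - lam * r ^ 2 / 3

/-- The derivative of the coefficient of `dt^2` in `t`. -/
noncomputable def lapseT (m q : ℝ → ℝ) (t r : ℝ) : ℝ :=
  -2 * deriv m t / r + 2 * q t * deriv q t / r ^ 2

/-- The derivative of the coefficient of `dt^2` in `r`. -/
noncomputable def lapseR (lam : ℝ) (m q : ℝ → ℝ) (t r : ℝ) : ℝ :=
  2 * m t / r ^ 2 - 2 * q t ^ 2 / r ^ 3 - 2 * lam * r / 3

/-- The second derivative of the coefficient of `dt^2` in `r`. -/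
noncomputable def lapseRR (lam : ℝ) (m q : ℝ → ℝ) (t r : ℝ) : ℝ :=
  -4 * m t / r ^ 3 + 6 * q t ^ 2 / r ^ 4 - 2 * lam / 3

/-- The mixed second derivative of the coefficient of `dt^2`. -/
noncomputable def lapseTR (m q : ℝ → ℝ) (t r : ℝ) : ℝ :=
  2 * deriv m t / r ^ 2 - 4 * q t * deriv q t / r ^ 3

section LapseDerivatives

variable {lam : ℝ} {m q : ℝ → ℝ} {t r : ℝ}

theorem hasDerivAt_lapse_left (hm : DifferentiableAt ℝ m t) (hq : DifferentiableAt ℝ q t) :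
    HasDerivAt (fun s => lapse lam m q s r) (lapseT m q t r) t := by
  unfold lapse lapseT
  have := ((((hm.hasDerivAt.const_mul 2).div_const r).const_sub 1).add
    ((hq.hasDerivAt.pow 2).div_const (r ^ 2))).sub_const (lam * r ^ 2 / 3)
  refine (this.congr_of_eventuallyEq (.of_forall fun s => ?_)).congr_deriv ?_
  · simp
  · simp
    ring

theorem hasDerivAt_lapse_right (hr : r ≠ 0) :
    HasDerivAt (fun s => lapse lam m q t s) (lapseR lam m q t r) r := by
  unfold lapse lapseR
  have := ((((hasDerivAt_inv hr).const_mul (2 * m t)).const_sub 1).add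
    (((hasDerivAt_pow 2 r).inv (pow_ne_zero 2 hr)).const_mul (q t ^ 2))).sub
    (((hasDerivAt_pow 2 r).const_mul lam).div_const 3)
  refine (this.congr_of_eventuallyEq (.of_forall fun s => ?_)).congr_deriv ?_
  · simp [div_eq_mul_inv]
  · simp
    field_simp
    ring

theorem hasDerivAt_lapseR_left (hm : DifferentiableAt ℝ m t) (hq : DifferentiableAt ℝ q t) :
    HasDerivAt (fun s => lapseR lam m q s r) (lapseTR m q t r) t := by
  unfold lapseR lapseTR
  have := (((hm.hasDerivAt.const_mul 2).div_const (r ^ 2)).sub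
    (((hq.hasDerivAt.pow 2).const_mul 2).div_const (r ^ 3))).sub_const (2 * lam * r / 3)
  refine (this.congr_of_eventuallyEq (.of_forall fun s => ?_)).congr_deriv ?_
  · simp
  · simp
    ring

theorem hasDerivAt_lapseR_right (hr : r ≠ 0) :
    HasDerivAt (fun s => lapseR lam m q t s) (lapseRR lam m q t r) r := by
  unfold lapseR lapseRR
  have := ((((hasDerivAt_pow 2 r).inv (pow_ne_zero 2 hr)).const_mul (2 * m t)).sub
    (((hasDerivAt_pow 3 r).inv (pow_ne_zero 3 hr)).const_mul (2 * q t ^ 2))).sub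
    (((hasDerivAt_id r).const_mul (2 * lam)).div_const 3)
  refine (this.congr_of_eventuallyEq (.of_forall fun s => ?_)).congr_deriv ?_
  · simp [div_eq_mul_inv]
  · simp
    field_simp
    ring

theorem hasDerivAt_lapseT_right (hr : r ≠ 0) :
    HasDerivAt (fun s => lapseT m q t s) (lapseTR m q t r) r := by
  unfold lapseT lapseTR
  have := ((hasDerivAt_inv hr).const_mul (-2 * deriv m t)).add
    (((hasDerivAt_pow 2 r).inv (pow_ne_zero 2 hr)).const_mul (2 * q t * deriv q t))
  refine (this.congr_of_eventuallyEq (.of_forall fun s => ?_)).congr_deriv ?_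
  · simp [div_eq_mul_inv]
  · simp
    field_simp
    ring

end LapseDerivatives

/-! ### Inverse metric and Christoffel symbols -/

/-- The inverse of the Vaidya-Bonner-de Sitter metric. -/
noncomputable def vbdsInverse (lam : ℝ) (m q : ℝ → ℝ) (x : Pt 4) : Fin 4 → Fin 4 → ℝ :=
  ![![0, -1, 0, 0],
    ![-1, -lapse lam m q (x 0) (x 1), 0, 0],
    ![0, 0, -(x 1 ^ 2)⁻¹, 0],
    ![0, 0, 0, -(x 1 ^ 2 * Real.sin (x 2) ^ 2)⁻¹]]

theorem vbdsMetric_apply (lam : ℝ) (m q : ℝ → ℝ) (x : Pt 4) : vbdsMetric lam m q x =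
    ![![lapse lam m q (x 0) (x 1), -1, 0, 0], ![-1, 0, 0, 0], ![0, 0, -x 1 ^ 2, 0],
      ![0, 0, 0, -(x 1 ^ 2 * Real.sin (x 2) ^ 2)]] := rfl

theorem inverseMetric_vbdsMetric {lam : ℝ} {m q : ℝ → ℝ} {x : Pt 4} (h1 : x 1 ≠ 0)
    (h2 : Real.sin (x 2) ≠ 0) :
    inverseMetric (vbdsMetric lam m q) x = Matrix.of (vbdsInverse lam m q x) := by
  refine Matrix.inv_eq_right_inv ?_
  ext i j
  revert i j
  simp only [forall_fin_four, vbdsMetric_apply, vbdsInverse, Matrix.mul_apply, Fin.sum_univ_four]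
  simp
  field_simp
  simp

/-- The derivatives of the components of the metric; the first index is the one of the
derivative. -/
noncomputable def vbdsMetricDeriv (lam : ℝ) (m q : ℝ → ℝ) (x : Pt 4) :
    Fin 4 → Fin 4 → Fin 4 → ℝ :=
  ![![![lapseT m q (x 0) (x 1), 0, 0, 0], 0, 0, 0],
    ![![lapseR lam m q (x 0) (x 1), 0, 0, 0], 0, ![0, 0, -(2 * x 1), 0],
      ![0, 0, 0, -(2 * x 1 * Real.sin (x 2) ^ 2)]],
    ![0, 0, 0, ![0, 0, 0, -(x 1 ^ 2 * (2 * Real.sin (x 2) * Real.cos (x 2)))]],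
    0]

theorem pd_vbdsMetric {lam : ℝ} {m q : ℝ → ℝ} {x : Pt 4} (hm : DifferentiableAt ℝ m (x 0))
    (hq : DifferentiableAt ℝ q (x 0)) (h1 : x 1 ≠ 0) (i j k : Fin 4) :
    pd i (fun y => vbdsMetric lam m q y j k) x = vbdsMetricDeriv lam m q x i j k := by
  have a0 : pd 0 (fun y => lapse lam m q (y 0) (y 1)) x = _ :=
    pd_zero_eq (F := fun t r _ => lapse lam m q t r) (hasDerivAt_lapse_left hm hq)
  have a1 : pd 1 (fun y => lapse lam m q (y 0) (y 1)) x = _ :=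
    pd_one_eq (F := fun t r _ => lapse lam m q t r) (hasDerivAt_lapse_right h1)
  have a2 : pd 2 (fun y => lapse lam m q (y 0) (y 1)) x = 0 :=
    pd_two_eq (F := fun t r _ => lapse lam m q t r) (hasDerivAt_const _ _)
  have a3 : pd 3 (fun y => lapse lam m q (y 0) (y 1)) x = 0 :=
    pd_three_eq (fun t r _ => lapse lam m q t r) x
  have b0 : pd 0 (fun y => y 1 ^ 2) x = 0 :=
    pd_zero_eq (F := fun _ r _ => r ^ 2) (hasDerivAt_const _ _)
  have b1 : pd 1 (fun y => y 1 ^ 2) x = 2 * x 1 :=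
    pd_one_eq (F := fun _ r _ => r ^ 2) (by simpa using hasDerivAt_pow 2 (x 1))
  have b2 : pd 2 (fun y => y 1 ^ 2) x = 0 :=
    pd_two_eq (F := fun _ r _ => r ^ 2) (hasDerivAt_const _ _)
  have b3 : pd 3 (fun y => y 1 ^ 2) x = 0 := pd_three_eq (fun _ r _ => r ^ 2) x
  have c0 : pd 0 (fun y => y 1 ^ 2 * Real.sin (y 2) ^ 2) x = 0 :=
    pd_zero_eq (F := fun _ r s => r ^ 2 * Real.sin s ^ 2) (hasDerivAt_const _ _)
  have c1 : pd 1 (fun y => y 1 ^ 2 * Real.sin (y 2) ^ 2) x = 2 * x 1 * Real.sin (x 2) ^ 2 :=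
    pd_one_eq (F := fun _ r s => r ^ 2 * Real.sin s ^ 2)
      (by simpa using (hasDerivAt_pow 2 (x 1)).mul_const (Real.sin (x 2) ^ 2))
  have c2 : pd 2 (fun y => y 1 ^ 2 * Real.sin (y 2) ^ 2) x
      = x 1 ^ 2 * (2 * Real.sin (x 2) * Real.cos (x 2)) :=
    pd_two_eq (F := fun _ r s => r ^ 2 * Real.sin s ^ 2)
      (by simpa using ((Real.hasDerivAt_sin (x 2)).pow 2).const_mul (x 1 ^ 2))
  have c3 : pd 3 (fun y => y 1 ^ 2 * Real.sin (y 2) ^ 2) x = 0 :=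
    pd_three_eq (fun _ r s => r ^ 2 * Real.sin s ^ 2) x
  revert i j k
  simp [forall_fin_four, vbdsMetric_apply, vbdsMetricDeriv, pd_const, pd_neg, a0, a1, a2, a3,
    b0, b1, b2, b3, c0, c1, c2, c3]

/-- The Christoffel symbols of the Vaidya-Bonner-de Sitter metric. -/
noncomputable def vbdsChristoffel (lam : ℝ) (m q : ℝ → ℝ) (x : Pt 4) :
    Fin 4 → Fin 4 → Fin 4 → ℝ :=
  ![![![lapseR lam m q (x 0) (x 1) / 2, 0, 0, 0], 0, ![0, 0, -x 1, 0],
      ![0, 0, 0, -(x 1 * Real.sin (x 2) ^ 2)]],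
    ![![(lapse lam m q (x 0) (x 1) * lapseR lam m q (x 0) (x 1) - lapseT m q (x 0) (x 1)) / 2,
        -(lapseR lam m q (x 0) (x 1) / 2), 0, 0],
      ![-(lapseR lam m q (x 0) (x 1) / 2), 0, 0, 0],
      ![0, 0, -(lapse lam m q (x 0) (x 1) * x 1), 0],
      ![0, 0, 0, -(lapse lam m q (x 0) (x 1) * x 1 * Real.sin (x 2) ^ 2)]],
    ![0, ![0, 0, (x 1)⁻¹, 0], ![0, (x 1)⁻¹, 0, 0],
      ![0, 0, 0, -(Real.sin (x 2) * Real.cos (x 2))]],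
    ![0, ![0, 0, 0, (x 1)⁻¹], ![0, 0, 0, Real.cos (x 2) / Real.sin (x 2)],
      ![0, (x 1)⁻¹, Real.cos (x 2) / Real.sin (x 2), 0]]]

theorem christoffel_vbdsMetric {lam : ℝ} {m q : ℝ → ℝ} {x : Pt 4}
    (hm : DifferentiableAt ℝ m (x 0)) (hq : DifferentiableAt ℝ q (x 0)) (h1 : x 1 ≠ 0)
    (h2 : Real.sin (x 2) ≠ 0) (k i j : Fin 4) :
    christoffel (vbdsMetric lam m q) k i j x = vbdsChristoffel lam m q x k i j := by
  simp only [christoffel, inverseMetric_vbdsMetric h1 h2, pd_vbdsMetric hm hq h1,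
    Fin.sum_univ_four, Matrix.of_apply]
  revert k i j
  simp only [forall_fin_four]
  refine ⟨⟨⟨?_, ?_, ?_, ?_⟩, ⟨?_, ?_, ?_, ?_⟩, ⟨?_, ?_, ?_, ?_⟩, ?_, ?_, ?_, ?_⟩,
    ⟨⟨?_, ?_, ?_, ?_⟩, ⟨?_, ?_, ?_, ?_⟩, ⟨?_, ?_, ?_, ?_⟩, ?_, ?_, ?_, ?_⟩,
    ⟨⟨?_, ?_, ?_, ?_⟩, ⟨?_, ?_, ?_, ?_⟩, ⟨?_, ?_, ?_, ?_⟩, ?_, ?_, ?_, ?_⟩,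
    ⟨⟨?_, ?_, ?_, ?_⟩, ⟨?_, ?_, ?_, ?_⟩, ⟨?_, ?_, ?_, ?_⟩, ?_, ?_, ?_, ?_⟩⟩ <;>
  (simp [vbdsInverse, vbdsMetricDeriv, vbdsChristoffel]; try field_simp; try ring)

/-- The derivatives of the Christoffel symbols; the first index is the one of the derivative. The
entry `∂_0 Γ^1_{00}`, which does not enter into the curvature, is left out. -/
noncomputable def vbdsChristoffelDeriv (lam : ℝ) (m q : ℝ → ℝ) (x : Pt 4) :
    Fin 4 → Fin 4 → Fin 4 → Fin 4 → ℝ :=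
  ![![![![lapseTR m q (x 0) (x 1) / 2, 0, 0, 0], 0, 0, 0],
      ![![0, -(lapseTR m q (x 0) (x 1) / 2), 0, 0], ![-(lapseTR m q (x 0) (x 1) / 2), 0, 0, 0],
        ![0, 0, -(lapseT m q (x 0) (x 1) * x 1), 0],
        ![0, 0, 0, -(lapseT m q (x 0) (x 1) * x 1 * Real.sin (x 2) ^ 2)]],
      0, 0],
    ![![![lapseRR lam m q (x 0) (x 1) / 2, 0, 0, 0], 0, ![0, 0, -1, 0],
        ![0, 0, 0, -Real.sin (x 2) ^ 2]],
      ![![(lapseR lam m q (x 0) (x 1) ^ 2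
            + lapse lam m q (x 0) (x 1) * lapseRR lam m q (x 0) (x 1)
            - lapseTR m q (x 0) (x 1)) / 2, -(lapseRR lam m q (x 0) (x 1) / 2), 0, 0],
        ![-(lapseRR lam m q (x 0) (x 1) / 2), 0, 0, 0],
        ![0, 0, -(lapseR lam m q (x 0) (x 1) * x 1 + lapse lam m q (x 0) (x 1)), 0],
        ![0, 0, 0, -((lapseR lam m q (x 0) (x 1) * x 1 + lapse lam m q (x 0) (x 1))
          * Real.sin (x 2) ^ 2)]],
      ![0, ![0, 0, -(x 1 ^ 2)⁻¹, 0], ![0, -(x 1 ^ 2)⁻¹, 0, 0], 0],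
      ![0, ![0, 0, 0, -(x 1 ^ 2)⁻¹], 0, ![0, -(x 1 ^ 2)⁻¹, 0, 0]]],
    ![![0, 0, 0, ![0, 0, 0, -(x 1 * (2 * Real.sin (x 2) * Real.cos (x 2)))]],
      ![0, 0, 0, ![0, 0, 0,
        -(lapse lam m q (x 0) (x 1) * x 1 * (2 * Real.sin (x 2) * Real.cos (x 2)))]],
      ![0, 0, 0, ![0, 0, 0, Real.sin (x 2) ^ 2 - Real.cos (x 2) ^ 2]],
      ![0, 0, ![0, 0, 0, -1 - (Real.cos (x 2) / Real.sin (x 2)) ^ 2],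
        ![0, 0, -1 - (Real.cos (x 2) / Real.sin (x 2)) ^ 2, 0]]],
    0]

/-- The condition on `i` and `l` excludes the derivatives ∂₀Γ^k_{j0}. Among them ∂₀Γ¹₀₀ would
require second derivatives of m and q, whereas all the others need only first derivatives. -/
theorem pd_christoffel_vbdsMetric {lam : ℝ} {I : Set ℝ} (hI : IsOpen I) {m q : ℝ → ℝ}
    (hm : DifferentiableOn ℝ m I) (hq : DifferentiableOn ℝ q I) {x : Pt 4} (hx : x ∈ vbdsChart I)
    {i k j l : Fin 4} (h : i ≠ 0 ∨ l ≠ 0) :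
    pd i (christoffel (vbdsMetric lam m q) k j l) x = vbdsChristoffelDeriv lam m q x i k j l := by
  rw [pd_congr (isOpen_vbdsChart hI) (g := fun y => vbdsChristoffel lam m q y k j l)
    (fun y hy => christoffel_vbdsMetric (hm.differentiableAt (hI.mem_nhds hy.1))
      (hq.differentiableAt (hI.mem_nhds hy.1)) hy.2.1 hy.2.2 k j l) hx i]
  obtain ⟨h0, h1, h2⟩ := hx
  replace hm := hm.differentiableAt (hI.mem_nhds h0)
  replace hq := hq.differentiableAt (hI.mem_nhds h0)
  have a0 : pd 0 (fun y => lapseR lam m q (y 0) (y 1) / 2) x = _ :=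
    pd_zero_eq (F := fun t r _ => lapseR lam m q t r / 2)
      ((hasDerivAt_lapseR_left hm hq).div_const 2)
  have a1 : pd 1 (fun y => lapseR lam m q (y 0) (y 1) / 2) x = _ :=
    pd_one_eq (F := fun t r _ => lapseR lam m q t r / 2)
      ((hasDerivAt_lapseR_right h1).div_const 2)
  have a2 : pd 2 (fun y => lapseR lam m q (y 0) (y 1) / 2) x = 0 :=
    pd_two_eq (F := fun t r _ => lapseR lam m q t r / 2)
      (hasDerivAt_const _ _)
  have a3 : pd 3 (fun y => lapseR lam m q (y 0) (y 1) / 2) x = 0 :=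
    pd_three_eq (fun t r _ => lapseR lam m q t r / 2) x
  have b0 : pd 0 (fun y => y 1) x = 0 :=
    pd_zero_eq (F := fun _ r _ => r)
      (hasDerivAt_const _ _)
  have b1 : pd 1 (fun y => y 1) x = _ :=
    pd_one_eq (F := fun _ r _ => r)
      (hasDerivAt_id (x 1))
  have b2 : pd 2 (fun y => y 1) x = 0 :=
    pd_two_eq (F := fun _ r _ => r)
      (hasDerivAt_const _ _)
  have b3 : pd 3 (fun y => y 1) x = 0 :=
    pd_three_eq (fun _ r _ => r) x
  have c0 : pd 0 (fun y => y 1 * Real.sin (y 2) ^ 2) x = 0 :=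
    pd_zero_eq (F := fun _ r s => r * Real.sin s ^ 2)
      (hasDerivAt_const _ _)
  have c1 : pd 1 (fun y => y 1 * Real.sin (y 2) ^ 2) x = _ :=
    pd_one_eq (F := fun _ r s => r * Real.sin s ^ 2)
      ((hasDerivAt_id (x 1)).mul_const (Real.sin (x 2) ^ 2))
  have c2 : pd 2 (fun y => y 1 * Real.sin (y 2) ^ 2) x = _ :=
    pd_two_eq (F := fun _ r s => r * Real.sin s ^ 2)
      (((Real.hasDerivAt_sin (x 2)).pow 2).const_mul (x 1))
  have c3 : pd 3 (fun y => y 1 * Real.sin (y 2) ^ 2) x = 0 :=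
    pd_three_eq (fun _ r s => r * Real.sin s ^ 2) x
  have d1 : pd 1 (fun y => (lapse lam m q (y 0) (y 1) * lapseR lam m q (y 0) (y 1)
      - lapseT m q (y 0) (y 1)) / 2) x = _ :=
    pd_one_eq (F := fun t r _ => (lapse lam m q t r * lapseR lam m q t r - lapseT m q t r) / 2)
      ((((hasDerivAt_lapse_right h1).mul (hasDerivAt_lapseR_right h1)).sub
      (hasDerivAt_lapseT_right h1)).div_const 2)
  have d2 : pd 2 (fun y => (lapse lam m q (y 0) (y 1) * lapseR lam m q (y 0) (y 1)
      - lapseT m q (y 0) (y 1)) / 2) x = 0 :=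
    pd_two_eq (F := fun t r _ => (lapse lam m q t r * lapseR lam m q t r - lapseT m q t r) / 2)
      (hasDerivAt_const _ _)
  have d3 : pd 3 (fun y => (lapse lam m q (y 0) (y 1) * lapseR lam m q (y 0) (y 1)
      - lapseT m q (y 0) (y 1)) / 2) x = 0 :=
    pd_three_eq (fun t r _ => (lapse lam m q t r * lapseR lam m q t r - lapseT m q t r) / 2) x
  have e0 : pd 0 (fun y => lapse lam m q (y 0) (y 1) * y 1) x = _ :=
    pd_zero_eq (F := fun t r _ => lapse lam m q t r * r)
      ((hasDerivAt_lapse_left hm hq).mul_const (x 1))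
  have e1 : pd 1 (fun y => lapse lam m q (y 0) (y 1) * y 1) x = _ :=
    pd_one_eq (F := fun t r _ => lapse lam m q t r * r)
      ((hasDerivAt_lapse_right h1).mul (hasDerivAt_id (x 1)))
  have e2 : pd 2 (fun y => lapse lam m q (y 0) (y 1) * y 1) x = 0 :=
    pd_two_eq (F := fun t r _ => lapse lam m q t r * r)
      (hasDerivAt_const _ _)
  have e3 : pd 3 (fun y => lapse lam m q (y 0) (y 1) * y 1) x = 0 :=
    pd_three_eq (fun t r _ => lapse lam m q t r * r) x
  have f0 : pd 0 (fun y => lapse lam m q (y 0) (y 1) * y 1 * Real.sin (y 2) ^ 2) x = _ :=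
    pd_zero_eq (F := fun t r s => lapse lam m q t r * r * Real.sin s ^ 2)
      (((hasDerivAt_lapse_left hm hq).mul_const (x 1)).mul_const (Real.sin (x 2) ^ 2))
  have f1 : pd 1 (fun y => lapse lam m q (y 0) (y 1) * y 1 * Real.sin (y 2) ^ 2) x = _ :=
    pd_one_eq (F := fun t r s => lapse lam m q t r * r * Real.sin s ^ 2)
      (((hasDerivAt_lapse_right h1).mul (hasDerivAt_id (x 1))).mul_const
      (Real.sin (x 2) ^ 2))
  have f2 : pd 2 (fun y => lapse lam m q (y 0) (y 1) * y 1 * Real.sin (y 2) ^ 2) x = _ :=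
    pd_two_eq (F := fun t r s => lapse lam m q t r * r * Real.sin s ^ 2)
      (((Real.hasDerivAt_sin (x 2)).pow 2).const_mul
      (lapse lam m q (x 0) (x 1) * x 1))
  have f3 : pd 3 (fun y => lapse lam m q (y 0) (y 1) * y 1 * Real.sin (y 2) ^ 2) x = 0 :=
    pd_three_eq (fun t r s => lapse lam m q t r * r * Real.sin s ^ 2) x
  have i0 : pd 0 (fun y => (y 1)⁻¹) x = 0 :=
    pd_zero_eq (F := fun _ r _ => r⁻¹)
      (hasDerivAt_const _ _)
  have i1 : pd 1 (fun y => (y 1)⁻¹) x = _ :=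
    pd_one_eq (F := fun _ r _ => r⁻¹)
      (hasDerivAt_inv h1)
  have i2 : pd 2 (fun y => (y 1)⁻¹) x = 0 :=
    pd_two_eq (F := fun _ r _ => r⁻¹)
      (hasDerivAt_const _ _)
  have i3 : pd 3 (fun y => (y 1)⁻¹) x = 0 :=
    pd_three_eq (fun _ r _ => r⁻¹) x
  have j0 : pd 0 (fun y => Real.sin (y 2) * Real.cos (y 2)) x = 0 :=
    pd_zero_eq (F := fun _ _ s => Real.sin s * Real.cos s)
      (hasDerivAt_const _ _)
  have j1 : pd 1 (fun y => Real.sin (y 2) * Real.cos (y 2)) x = 0 :=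
    pd_one_eq (F := fun _ _ s => Real.sin s * Real.cos s)
      (hasDerivAt_const _ _)
  have j2 : pd 2 (fun y => Real.sin (y 2) * Real.cos (y 2)) x = _ :=
    pd_two_eq (F := fun _ _ s => Real.sin s * Real.cos s)
      ((Real.hasDerivAt_sin (x 2)).mul (Real.hasDerivAt_cos (x 2)))
  have j3 : pd 3 (fun y => Real.sin (y 2) * Real.cos (y 2)) x = 0 :=
    pd_three_eq (fun _ _ s => Real.sin s * Real.cos s) x
  have k0 : pd 0 (fun y => Real.cos (y 2) / Real.sin (y 2)) x = 0 :=
    pd_zero_eq (F := fun _ _ s => Real.cos s / Real.sin s)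
      (hasDerivAt_const _ _)
  have k1 : pd 1 (fun y => Real.cos (y 2) / Real.sin (y 2)) x = 0 :=
    pd_one_eq (F := fun _ _ s => Real.cos s / Real.sin s)
      (hasDerivAt_const _ _)
  have k2 : pd 2 (fun y => Real.cos (y 2) / Real.sin (y 2)) x = _ :=
    pd_two_eq (F := fun _ _ s => Real.cos s / Real.sin s)
      ((Real.hasDerivAt_cos (x 2)).div (Real.hasDerivAt_sin (x 2)) h2)
  have k3 : pd 3 (fun y => Real.cos (y 2) / Real.sin (y 2)) x = 0 :=
    pd_three_eq (fun _ _ s => Real.cos s / Real.sin s) x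
  revert i k j l
  simp only [forall_fin_four]
  simp [vbdsChristoffel, vbdsChristoffelDeriv, pd_const, pd_neg, a0, a1, a2, a3, b0, b1, b2,
    b3, c0, c1, c2, c3, d1, d2, d3, e0, e1, e2, e3, f0, f1, f2, f3, i0, i1, i2, i3, j0, j1, j2, j3, k0, k1, k2, k3]
  field_simp
  ring_nf
  exact ⟨trivial, trivial, trivial⟩

/-! ### Curvature in terms of the radial and angular blocks -/

/-- The `dt^2` and `dt dr` part of the metric. -/
noncomputable def vbdsRadial (lam : ℝ) (m q : ℝ → ℝ) : Cov2 4 := fun x =>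
  ![![lapse lam m q (x 0) (x 1), -1, 0, 0], ![-1, 0, 0, 0], 0, 0]

/-- The angular part of the metric. -/
noncomputable def vbdsAngular : Cov2 4 := fun x =>
  ![0, 0, ![0, 0, -x 1 ^ 2, 0], ![0, 0, 0, -(x 1 ^ 2 * Real.sin (x 2) ^ 2)]]

/-- The tensor `dt^2`. -/
def nullSquare : Cov2 4 := fun _ => ![![1, 0, 0, 0], 0, 0, 0]

theorem vbdsMetric_eq_add (lam : ℝ) (m q : ℝ → ℝ) (x : Pt 4) (i j : Fin 4) :
    vbdsMetric lam m q x i j = vbdsRadial lam m q x i j + vbdsAngular x i j := by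
  revert i j
  simp [forall_fin_four, vbdsMetric_apply, vbdsRadial, vbdsAngular]

theorem riemann_antisymm {n : ℕ} (g : Cov2 n) (x : Pt n) (e f s t : Fin n) :
    riemann g x e f s t = -riemann g x e f t s := by
  simp only [riemann, ← Finset.sum_neg_distrib]
  refine Finset.sum_congr rfl fun a _ => ?_
  rw [← mul_neg, neg_add, ← Finset.sum_neg_distrib]
  congr 1
  congr 1
  · ring
  · exact Finset.sum_congr rfl fun b _ => by ring

theorem kulkarniNomizu_antisymm {n : ℕ} (A B : Cov2 n) (x : Pt n) (e f s t : Fin n) :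
    kulkarniNomizu A B x e f s t = -kulkarniNomizu A B x e f t s := by
  simp only [kulkarniNomizu]
  ring

set_option maxHeartbeats 4000000 in
-- This is the curvature of a warped product with warping function r. The radial term is the
-- curvature of the base surface, the mixed terms are (1/r) Hess r ∧ g₂ with Hess r = −(A_r/2) g₁ +
-- (A_t/2) dt² on the base, and the angular term is the curvature of the sphere corrected by |dr|².
theorem riemann_vbdsMetric {lam : ℝ} {I : Set ℝ} (hI : IsOpen I) {m q : ℝ → ℝ}
    (hm : DifferentiableOn ℝ m I) (hq : DifferentiableOn ℝ q I) {x : Pt 4} (hx : x ∈ vbdsChart I)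
    (e f s t : Fin 4) :
    riemann (vbdsMetric lam m q) x e f s t
      = -(lapseRR lam m q (x 0) (x 1) / 4)
          * kulkarniNomizu (vbdsRadial lam m q) (vbdsRadial lam m q) x e f s t
        - lapseR lam m q (x 0) (x 1) / (2 * x 1)
          * kulkarniNomizu (vbdsRadial lam m q) vbdsAngular x e f s t
        + (1 - lapse lam m q (x 0) (x 1)) / (2 * x 1 ^ 2)
          * kulkarniNomizu vbdsAngular vbdsAngular x e f s t
        + lapseT m q (x 0) (x 1) / (2 * x 1)
          * kulkarniNomizu vbdsAngular nullSquare x e f s t := by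
  obtain ⟨h0, h1, h2⟩ := id hx
  have hm' := hm.differentiableAt (hI.mem_nhds h0)
  have hq' := hq.differentiableAt (hI.mem_nhds h0)
  have key : ∀ s t, s < t → riemann (vbdsMetric lam m q) x e f s t
      = ∑ a, vbdsMetric lam m q x e a * (vbdsChristoffelDeriv lam m q x s a f t
        - vbdsChristoffelDeriv lam m q x t a f s
        + ∑ b, (vbdsChristoffel lam m q x b f t * vbdsChristoffel lam m q x a b s
          - vbdsChristoffel lam m q x b f s * vbdsChristoffel lam m q x a b t)) := by
    intro s t hst
    simp only [riemann, christoffel_vbdsMetric hm' hq' h1 h2]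
    refine Finset.sum_congr rfl fun a _ => ?_
    -- For s < t, every derivative of Γ that occurs carries t either as its direction or as its last
    -- lower index, so ∂₀Γ¹₀₀ never arises.
    have ht : t ≠ 0 := (lt_of_le_of_lt (Fin.zero_le s) hst).ne'
    rw [pd_christoffel_vbdsMetric hI hm hq hx (Or.inr ht),
      pd_christoffel_vbdsMetric hI hm hq hx (Or.inl ht)]
  revert s t
  refine antisymm_ext_four (fun s t => riemann_antisymm _ _ _ _ _ _) (fun s t => ?_)
    ?_ ?_ ?_ ?_ ?_ ?_
  · rw [kulkarniNomizu_antisymm _ _ _ _ _ s, kulkarniNomizu_antisymm _ _ _ _ _ s,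
      kulkarniNomizu_antisymm _ _ _ _ _ s, kulkarniNomizu_antisymm _ _ _ _ _ s]
    ring
  all_goals
    rw [key _ _ (by decide)]
    simp only [vbdsMetric_apply, Fin.sum_univ_four]
    clear key
    revert e f
    simp only [forall_fin_four]
    refine ⟨⟨?_, ?_, ?_, ?_⟩, ⟨?_, ?_, ?_, ?_⟩, ⟨?_, ?_, ?_, ?_⟩, ?_, ?_, ?_, ?_⟩ <;>
    (simp [vbdsChristoffel, vbdsChristoffelDeriv, kulkarniNomizu, vbdsRadial, vbdsAngular,
      nullSquare, h1, h2]; try field_simp; try ring)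

/-- The coefficient of the Weyl tensor. -/
noncomputable def weylScalar (m q : ℝ → ℝ) (x : Pt 4) : ℝ := (x 1 * m (x 0) - q (x 0) ^ 2) / x 1 ^ 4

/-- Half the difference of the eigenvalues of the Ricci tensor. -/
noncomputable def chargeScalar (q : ℝ → ℝ) (x : Pt 4) : ℝ := q (x 0) ^ 2 / x 1 ^ 4

/-- The coefficient of the null part of the Ricci tensor. -/
noncomputable def fluxScalar (m q : ℝ → ℝ) (x : Pt 4) : ℝ := lapseT m q (x 0) (x 1) / x 1

/-- On a plane a curvature-like tensor has one component, and that of g₁∧dt² is proportional to the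
g₁-trace of dt², which is zero because dt is null. This removes the flux from the Weyl tensor: the
term g₂∧dt² of R cancels against that of g∧S, and g₁∧dt² vanishes. -/
theorem kulkarniNomizu_radial_nullSquare (lam : ℝ) (m q : ℝ → ℝ) (x : Pt 4) (e f s t : Fin 4) :
    kulkarniNomizu (vbdsRadial lam m q) nullSquare x e f s t = 0 := by
  revert e f
  refine antisymm_ext_four (G := fun _ _ => 0) (fun e f => ?_) (by simp) ?_ ?_ ?_ ?_ ?_ ?_
  · simp only [kulkarniNomizu]
    ring
  all_goals
    revert s t
    simp [forall_fin_four, kulkarniNomizu, vbdsRadial, nullSquare]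

section

variable {lam : ℝ} {I : Set ℝ} {m q : ℝ → ℝ} {x : Pt 4}

theorem riemann_vbdsMetric_eq (hI : IsOpen I)
    (hm : DifferentiableOn ℝ m I) (hq : DifferentiableOn ℝ q I) (hx : x ∈ vbdsChart I)
    (e f s t : Fin 4) :
    riemann (vbdsMetric lam m q) x e f s t
      = (weylScalar m q x - chargeScalar q x / 2 + lam / 6)
          * kulkarniNomizu (vbdsRadial lam m q) (vbdsRadial lam m q) x e f s t
        + (lam / 3 - weylScalar m q x)
          * kulkarniNomizu (vbdsRadial lam m q) vbdsAngular x e f s t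
        + (weylScalar m q x + chargeScalar q x / 2 + lam / 6)
          * kulkarniNomizu vbdsAngular vbdsAngular x e f s t
        + fluxScalar m q x / 2 * kulkarniNomizu vbdsAngular nullSquare x e f s t := by
  have h1 := hx.2.1
  have e1 : -(lapseRR lam m q (x 0) (x 1) / 4)
      = weylScalar m q x - chargeScalar q x / 2 + lam / 6 := by
    simp only [lapseRR, weylScalar, chargeScalar]
    field_simp
    ring
  have e2 : lapseR lam m q (x 0) (x 1) / (2 * x 1) = -(lam / 3 - weylScalar m q x) := by
    simp only [lapseR, weylScalar]
    field_simp
    ring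
  have e3 : (1 - lapse lam m q (x 0) (x 1)) / (2 * x 1 ^ 2)
      = weylScalar m q x + chargeScalar q x / 2 + lam / 6 := by
    simp only [lapse, weylScalar, chargeScalar]
    field_simp
    ring
  have e4 : lapseT m q (x 0) (x 1) / (2 * x 1) = fluxScalar m q x / 2 := by
    simp only [fluxScalar]
    field_simp
  rw [riemann_vbdsMetric hI hm hq hx, e1, e2, e3, e4]
  ring

theorem ricci_vbdsMetric (hI : IsOpen I)
    (hm : DifferentiableOn ℝ m I) (hq : DifferentiableOn ℝ q I) (hx : x ∈ vbdsChart I)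
    (i j : Fin 4) :
    ricci (vbdsMetric lam m q) x i j
      = (lam - chargeScalar q x) * vbdsRadial lam m q x i j
        + (lam + chargeScalar q x) * vbdsAngular x i j + fluxScalar m q x * nullSquare x i j := by
  obtain ⟨-, h1, h2⟩ := id hx
  simp only [ricci, riemann_vbdsMetric_eq hI hm hq hx, inverseMetric_vbdsMetric h1 h2,
    Matrix.of_apply, Fin.sum_univ_four]
  revert i j
  simp only [forall_fin_four]
  refine ⟨⟨?_, ?_, ?_, ?_⟩, ⟨?_, ?_, ?_, ?_⟩, ⟨?_, ?_, ?_, ?_⟩, ?_, ?_, ?_, ?_⟩ <;>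
  (simp [vbdsInverse, kulkarniNomizu, vbdsRadial, vbdsAngular, nullSquare]; try field_simp
   try ring)

theorem scalarCurv_vbdsMetric (hI : IsOpen I)
    (hm : DifferentiableOn ℝ m I) (hq : DifferentiableOn ℝ q I) (hx : x ∈ vbdsChart I) :
    scalarCurv (vbdsMetric lam m q) x = 4 * lam := by
  obtain ⟨-, h1, h2⟩ := id hx
  simp only [scalarCurv, ricci_vbdsMetric hI hm hq hx, inverseMetric_vbdsMetric h1 h2,
    Matrix.of_apply, Fin.sum_univ_four]
  simp [vbdsInverse, vbdsRadial, vbdsAngular, nullSquare]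
  field_simp
  ring

theorem weyl_vbdsMetric (hI : IsOpen I)
    (hm : DifferentiableOn ℝ m I) (hq : DifferentiableOn ℝ q I) (hx : x ∈ vbdsChart I)
    (e f s t : Fin 4) :
    weyl (vbdsMetric lam m q) x e f s t
      = weylScalar m q x * (kulkarniNomizu (vbdsRadial lam m q) (vbdsRadial lam m q) x e f s t
        - kulkarniNomizu (vbdsRadial lam m q) vbdsAngular x e f s t
        + kulkarniNomizu vbdsAngular vbdsAngular x e f s t) := by
  have h := kulkarniNomizu_radial_nullSquare lam m q x e f s t
  simp only [weyl, riemann_vbdsMetric_eq hI hm hq hx, scalarCurv_vbdsMetric hI hm hq hx,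
    kulkarniNomizu, ricci_vbdsMetric hI hm hq hx, vbdsMetric_eq_add] at h ⊢
  push_cast
  linear_combination (-fluxScalar m q x / 2) * h

theorem conharmonic_vbdsMetric (hI : IsOpen I)
    (hm : DifferentiableOn ℝ m I) (hq : DifferentiableOn ℝ q I) (hx : x ∈ vbdsChart I)
    (e f s t : Fin 4) :
    conharmonic (vbdsMetric lam m q) x e f s t
      = weylScalar m q x * (kulkarniNomizu (vbdsRadial lam m q) (vbdsRadial lam m q) x e f s t
        - kulkarniNomizu (vbdsRadial lam m q) vbdsAngular x e f s t
        + kulkarniNomizu vbdsAngular vbdsAngular x e f s t)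
        - lam / 3 * kulkarniNomizu (vbdsMetric lam m q) (vbdsMetric lam m q) x e f s t := by
  rw [← weyl_vbdsMetric hI hm hq hx]
  simp only [weyl, conharmonic, scalarCurv_vbdsMetric hI hm hq hx]
  push_cast
  ring

end

/-! ### Linearity of the curvature action; the operator of g∧g -/

section Linear

variable {n : ℕ}

theorem raiseFirst_add (g : Cov2 n) (K L : Cov4 n) (x : Pt n) (a f s t : Fin n) :
    raiseFirst g (fun y b c d e => K y b c d e + L y b c d e) x a f s t
      = raiseFirst g K x a f s t + raiseFirst g L x a f s t := by
  simp only [raiseFirst, mul_add, Finset.sum_add_distrib]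

theorem raiseFirst_smul (g : Cov2 n) (k : ℝ) (L : Cov4 n) (x : Pt n) (a f s t : Fin n) :
    raiseFirst g (fun y b c d e => k * L y b c d e) x a f s t = k * raiseFirst g L x a f s t := by
  simp only [raiseFirst, Finset.mul_sum]
  exact Finset.sum_congr rfl fun _ _ => by ring

theorem curvDot_add_left (g : Cov2 n) (K L W : Cov4 n) (x : Pt n) (b c d f r s : Fin n) :
    curvDot g (fun y b c d e => K y b c d e + L y b c d e) W x b c d f r s
      = curvDot g K W x b c d f r s + curvDot g L W x b c d f r s := by
  simp only [curvDot_eq_deriv4, raiseFirst_add, deriv4_add_left, neg_add]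

theorem curvDot_smul_left (g : Cov2 n) (k : ℝ) (L W : Cov4 n) (x : Pt n) (b c d f r s : Fin n) :
    curvDot g (fun y b c d e => k * L y b c d e) W x b c d f r s
      = k * curvDot g L W x b c d f r s := by
  simp only [curvDot_eq_deriv4, raiseFirst_smul, deriv4_smul_left, mul_neg]

theorem curvDot_congr (g : Cov2 n) {K L V W : Cov4 n} {x : Pt n} (hL : K x = L x) (hW : V x = W x)
    (b c d f r s : Fin n) : curvDot g K V x b c d f r s = curvDot g L W x b c d f r s := by
  simp only [curvDot, raiseFirst, hL, hW]

theorem raiseFirst_kulkarniNomizu_self {g : Cov2 n} {x : Pt n}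
    (h : IsUnit (Matrix.of (g x)).det) (a f s t : Fin n) :
    raiseFirst g (kulkarniNomizu g g) x a f s t
      = 2 * ((if a = t then g x f s else 0) - (if a = s then g x f t else 0)) := by
  have h' : ∀ c, ∑ e, inverseMetric g x a e * g x e c = if a = c then 1 else 0 := fun c => by
    have := congrFun (congrFun (Matrix.nonsing_inv_mul _ h) a) c
    rwa [Matrix.mul_apply, Matrix.one_apply] at this
  have : raiseFirst g (kulkarniNomizu g g) x a f s t
      = 2 * ((∑ e, inverseMetric g x a e * g x e t) * g x f s
        - (∑ e, inverseMetric g x a e * g x e s) * g x f t) := by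
    simp only [raiseFirst, kulkarniNomizu, Finset.sum_mul, mul_sub, Finset.mul_sum,
      ← Finset.sum_sub_distrib]
    exact Finset.sum_congr rfl fun _ _ => by ring
  rw [this, h', h', ite_mul, ite_mul, one_mul, one_mul, zero_mul, zero_mul]

/-- The Tachibana tensor of the metric is the action of the tensor of constant curvature. -/
theorem curvDot_kulkarniNomizu_self {g : Cov2 n} {x : Pt n}
    (h : IsUnit (Matrix.of (g x)).det) (hs : ∀ i j, g x i j = g x j i) (W : Cov4 n)
    (b c d f r s : Fin n) :
    curvDot g (kulkarniNomizu g g) W x b c d f r s = 2 * tachibana g W x b c d f r s := by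
  simp only [curvDot_eq_deriv4, raiseFirst_kulkarniNomizu_self h, deriv4_smul_left,
    tachibana_eq_deriv4, ← mul_neg]
  congr 1
  simp only [deriv4, ← Finset.sum_neg_distrib, hs _ r, hs _ s]
  exact Finset.sum_congr rfl fun _ _ => by ring

end Linear

theorem isUnit_det_vbdsMetric (lam : ℝ) (m q : ℝ → ℝ) {x : Pt 4} (h1 : x 1 ≠ 0)
    (h2 : Real.sin (x 2) ≠ 0) : IsUnit (Matrix.of (vbdsMetric lam m q x)).det := by
  refine (Matrix.isUnit_iff_isUnit_det _).mp (.of_mul_eq_one (Matrix.of (vbdsInverse lam m q x)) ?_)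
  ext i j
  revert i j
  simp only [forall_fin_four, vbdsMetric_apply, vbdsInverse, Matrix.mul_apply, Fin.sum_univ_four]
  simp
  field_simp
  simp

theorem vbdsMetric_symm (lam : ℝ) (m q : ℝ → ℝ) (x : Pt 4) (i j : Fin 4) :
    vbdsMetric lam m q x i j = vbdsMetric lam m q x j i := by
  revert i j
  simp [forall_fin_four, vbdsMetric_apply]

/-! ### Action of the radial and angular curvature operators -/

section

variable {lam : ℝ} {I : Set ℝ} {m q : ℝ → ℝ} {x : Pt 4}

/-- Raising an index of g₁ with the full metric gives the projection onto the (t, r) plane, whence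
the condition `a < 2`; the angular block gives the complementary projection. -/
theorem raiseFirst_radial (h1 : x 1 ≠ 0) (h2 : Real.sin (x 2) ≠ 0) (a b r s : Fin 4) :
    raiseFirst (vbdsMetric lam m q)
        (kulkarniNomizu (vbdsRadial lam m q) (vbdsRadial lam m q)) x a b r s
      = 2 * ((if a = s ∧ a < 2 then vbdsRadial lam m q x b r else 0)
        - (if a = r ∧ a < 2 then vbdsRadial lam m q x b s else 0)) := by
  have hr : ∀ a c, ∑ e, inverseMetric (vbdsMetric lam m q) x a e * vbdsRadial lam m q x e c
      = if a = c ∧ a < 2 then 1 else 0 := by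
    simp [forall_fin_four, inverseMetric_vbdsMetric h1 h2, vbdsInverse, vbdsRadial,
      Fin.sum_univ_four]
  have : raiseFirst (vbdsMetric lam m q)
        (kulkarniNomizu (vbdsRadial lam m q) (vbdsRadial lam m q)) x a b r s
      = 2 * ((∑ e, inverseMetric (vbdsMetric lam m q) x a e * vbdsRadial lam m q x e s)
          * vbdsRadial lam m q x b r
        - (∑ e, inverseMetric (vbdsMetric lam m q) x a e * vbdsRadial lam m q x e r)
          * vbdsRadial lam m q x b s) := by
    simp only [raiseFirst, kulkarniNomizu, Finset.sum_mul, mul_sub, Finset.mul_sum,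
      ← Finset.sum_sub_distrib]
    exact Finset.sum_congr rfl fun _ _ => by ring
  rw [this, hr, hr, ite_mul, ite_mul, one_mul, one_mul, zero_mul, zero_mul]

theorem raiseFirst_angular (h1 : x 1 ≠ 0) (h2 : Real.sin (x 2) ≠ 0) (a b r s : Fin 4) :
    raiseFirst (vbdsMetric lam m q) (kulkarniNomizu vbdsAngular vbdsAngular) x a b r s
      = 2 * ((if a = s ∧ 2 ≤ a then vbdsAngular x b r else 0)
        - (if a = r ∧ 2 ≤ a then vbdsAngular x b s else 0)) := by
  have hr : ∀ a c, ∑ e, inverseMetric (vbdsMetric lam m q) x a e * vbdsAngular x e c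
      = if a = c ∧ 2 ≤ a then 1 else 0 := by
    simp [forall_fin_four, inverseMetric_vbdsMetric h1 h2, vbdsInverse, vbdsAngular,
      Fin.sum_univ_four, h1]
    field_simp
  have : raiseFirst (vbdsMetric lam m q) (kulkarniNomizu vbdsAngular vbdsAngular) x a b r s
      = 2 * ((∑ e, inverseMetric (vbdsMetric lam m q) x a e * vbdsAngular x e s)
          * vbdsAngular x b r
        - (∑ e, inverseMetric (vbdsMetric lam m q) x a e * vbdsAngular x e r)
          * vbdsAngular x b s) := by
    simp only [raiseFirst, kulkarniNomizu, Finset.sum_mul, mul_sub, Finset.mul_sum,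
      ← Finset.sum_sub_distrib]
    exact Finset.sum_congr rfl fun _ _ => by ring
  rw [this, hr, hr, ite_mul, ite_mul, one_mul, one_mul, zero_mul, zero_mul]

/-- By the Leibniz rule, a derivation that annihilates A and B annihilates their Kulkarni-Nomizu
products. -/
theorem deriv4_twoBlock {M : Fin 4 → Fin 4 → ℝ} {A B : Cov2 4}
    (hA : ∀ b c, deriv2 M (A x) b c = 0) (hB : ∀ b c, deriv2 M (B x) b c = 0)
    (k l p : ℝ) (b c d f : Fin 4) :
    deriv4 M (fun b c d f => k * kulkarniNomizu A A x b c d f + l * kulkarniNomizu A B x b c d f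
      + p * kulkarniNomizu B B x b c d f) b c d f = 0 := by
  simp only [deriv4_add_right, deriv4_smul_right, deriv4_kulkarniNomizu]
  simp only [kulkarniNomizu, hA, hB]
  ring

/-- The radial curvature operators preserve the tensors built from the two blocks of the metric. -/
theorem curvDot_radial_twoBlock (h1 : x 1 ≠ 0) (h2 : Real.sin (x 2) ≠ 0) (k l p : ℝ) (W : Cov4 4)
    (hW : ∀ b c d f, W x b c d f
      = k * kulkarniNomizu (vbdsRadial lam m q) (vbdsRadial lam m q) x b c d f
        + l * kulkarniNomizu (vbdsRadial lam m q) vbdsAngular x b c d f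
        + p * kulkarniNomizu vbdsAngular vbdsAngular x b c d f) (b c d f r s : Fin 4) :
    curvDot (vbdsMetric lam m q) (kulkarniNomizu (vbdsRadial lam m q) (vbdsRadial lam m q)) W
      x b c d f r s = 0 := by
  rw [curvDot_eq_deriv4, show W x = _ from funext fun b => funext fun c => funext fun d =>
    funext fun f => hW b c d f, deriv4_twoBlock, neg_zero]
  -- What remains is that each radial operator is skew for g₁ and annihilates g₂.
  all_goals
    simp only [raiseFirst_radial h1 h2, deriv2]
    revert r s
    simp [forall_fin_four, Fin.sum_univ_four, vbdsRadial, vbdsAngular]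

/-- The angular curvature operators preserve the tensors built from the two blocks of the metric. -/
theorem curvDot_angular_twoBlock (h1 : x 1 ≠ 0) (h2 : Real.sin (x 2) ≠ 0) (k l p : ℝ) (W : Cov4 4)
    (hW : ∀ b c d f, W x b c d f
      = k * kulkarniNomizu (vbdsRadial lam m q) (vbdsRadial lam m q) x b c d f
        + l * kulkarniNomizu (vbdsRadial lam m q) vbdsAngular x b c d f
        + p * kulkarniNomizu vbdsAngular vbdsAngular x b c d f) (b c d f r s : Fin 4) :
    curvDot (vbdsMetric lam m q) (kulkarniNomizu vbdsAngular vbdsAngular) W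
      x b c d f r s = 0 := by
  rw [curvDot_eq_deriv4, show W x = _ from funext fun b => funext fun c => funext fun d =>
    funext fun f => hW b c d f, deriv4_twoBlock, neg_zero]
  all_goals
    simp only [raiseFirst_angular h1 h2, deriv2]
    revert r s
    simp [forall_fin_four, Fin.sum_univ_four, vbdsRadial, vbdsAngular]
  constructor <;> ring

/-- The tensors built from the two blocks of the metric are pseudosymmetric for the operators of
the tensors `k (g₁ ∧ g₁ + g₂ ∧ g₂) + l g ∧ g`. -/
theorem curvDot_twoBlock (h1 : x 1 ≠ 0) (h2 : Real.sin (x 2) ≠ 0) (u v k l p : ℝ) (L W : Cov4 4)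
    (hL : ∀ b c d f, L x b c d f
      = u * kulkarniNomizu (vbdsRadial lam m q) (vbdsRadial lam m q) x b c d f
        + u * kulkarniNomizu vbdsAngular vbdsAngular x b c d f
        + v * kulkarniNomizu (vbdsMetric lam m q) (vbdsMetric lam m q) x b c d f)
    (hW : ∀ b c d f, W x b c d f
      = k * kulkarniNomizu (vbdsRadial lam m q) (vbdsRadial lam m q) x b c d f
        + l * kulkarniNomizu (vbdsRadial lam m q) vbdsAngular x b c d f
        + p * kulkarniNomizu vbdsAngular vbdsAngular x b c d f) (b c d f r s : Fin 4) :
    curvDot (vbdsMetric lam m q) L W x b c d f r s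
      = 2 * v * tachibana (vbdsMetric lam m q) W x b c d f r s := by
  rw [curvDot_congr (L := fun y b c d f =>
        u * kulkarniNomizu (vbdsRadial lam m q) (vbdsRadial lam m q) y b c d f
        + u * kulkarniNomizu vbdsAngular vbdsAngular y b c d f
        + v * kulkarniNomizu (vbdsMetric lam m q) (vbdsMetric lam m q) y b c d f) (W := W) _
      (by funext b c d f; exact hL b c d f) rfl]
  rw [curvDot_add_left _ (fun y b c d f =>
        u * kulkarniNomizu (vbdsRadial lam m q) (vbdsRadial lam m q) y b c d f
        + u * kulkarniNomizu vbdsAngular vbdsAngular y b c d f), curvDot_add_left,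
    curvDot_smul_left, curvDot_smul_left, curvDot_smul_left,
    curvDot_radial_twoBlock h1 h2 k l p W hW, curvDot_angular_twoBlock h1 h2 k l p W hW,
    curvDot_kulkarniNomizu_self (isUnit_det_vbdsMetric lam m q h1 h2) (vbdsMetric_symm lam m q x)]
  ring

end

section

variable {lam : ℝ} {I : Set ℝ} {m q : ℝ → ℝ} {x : Pt 4}

theorem weyl_eq_twoBlock (hI : IsOpen I) (hm : DifferentiableOn ℝ m I)
    (hq : DifferentiableOn ℝ q I) (hx : x ∈ vbdsChart I) (b c d f : Fin 4) :
    weyl (vbdsMetric lam m q) x b c d f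
      = weylScalar m q x * kulkarniNomizu (vbdsRadial lam m q) (vbdsRadial lam m q) x b c d f
        + -weylScalar m q x * kulkarniNomizu (vbdsRadial lam m q) vbdsAngular x b c d f
        + weylScalar m q x * kulkarniNomizu vbdsAngular vbdsAngular x b c d f := by
  rw [weyl_vbdsMetric hI hm hq hx]
  ring

theorem conharmonic_eq_twoBlock (hI : IsOpen I) (hm : DifferentiableOn ℝ m I)
    (hq : DifferentiableOn ℝ q I) (hx : x ∈ vbdsChart I) (b c d f : Fin 4) :
    conharmonic (vbdsMetric lam m q) x b c d f
      = (weylScalar m q x - lam / 3)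
          * kulkarniNomizu (vbdsRadial lam m q) (vbdsRadial lam m q) x b c d f
        + (-weylScalar m q x - 2 * lam / 3)
          * kulkarniNomizu (vbdsRadial lam m q) vbdsAngular x b c d f
        + (weylScalar m q x - lam / 3) * kulkarniNomizu vbdsAngular vbdsAngular x b c d f := by
  rw [conharmonic_vbdsMetric hI hm hq hx]
  simp only [kulkarniNomizu, vbdsMetric_eq_add]
  ring

theorem curvDot_weyl_twoBlock (hI : IsOpen I) (hm : DifferentiableOn ℝ m I)
    (hq : DifferentiableOn ℝ q I) (hx : x ∈ vbdsChart I) (k l p : ℝ) (W : Cov4 4)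
    (hW : ∀ b c d f, W x b c d f
      = k * kulkarniNomizu (vbdsRadial lam m q) (vbdsRadial lam m q) x b c d f
        + l * kulkarniNomizu (vbdsRadial lam m q) vbdsAngular x b c d f
        + p * kulkarniNomizu vbdsAngular vbdsAngular x b c d f) (b c d f r s : Fin 4) :
    curvDot (vbdsMetric lam m q) (weyl (vbdsMetric lam m q)) W x b c d f r s
      = -weylScalar m q x * tachibana (vbdsMetric lam m q) W x b c d f r s := by
  -- Since g∧g = g₁∧g₁ + 2 g₁∧g₂ + g₂∧g₂, the coefficient −w of g₁∧g₂ forces −w/2 in front of g∧g,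
  -- which leaves 3w/2 for the two diagonal terms.
  rw [curvDot_twoBlock hx.2.1 hx.2.2 (3 / 2 * weylScalar m q x) (-(weylScalar m q x / 2)) k l p _ W
    (fun b c d f => ?_) hW]
  · ring
  · rw [weyl_vbdsMetric hI hm hq hx]
    simp only [kulkarniNomizu, vbdsMetric_eq_add]
    ring

theorem curvDot_conharmonic_twoBlock (hI : IsOpen I) (hm : DifferentiableOn ℝ m I)
    (hq : DifferentiableOn ℝ q I) (hx : x ∈ vbdsChart I) (k l p : ℝ) (W : Cov4 4)
    (hW : ∀ b c d f, W x b c d f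
      = k * kulkarniNomizu (vbdsRadial lam m q) (vbdsRadial lam m q) x b c d f
        + l * kulkarniNomizu (vbdsRadial lam m q) vbdsAngular x b c d f
        + p * kulkarniNomizu vbdsAngular vbdsAngular x b c d f) (b c d f r s : Fin 4) :
    curvDot (vbdsMetric lam m q) (conharmonic (vbdsMetric lam m q)) W x b c d f r s
      = -(2 * lam / 3 + weylScalar m q x)
        * tachibana (vbdsMetric lam m q) W x b c d f r s := by
  -- The same splitting as for C, with the extra −(λ/3) g∧g of har(R).
  rw [curvDot_twoBlock hx.2.1 hx.2.2 (3 / 2 * weylScalar m q x)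
    (-(weylScalar m q x / 2) - lam / 3) k l p _ W (fun b c d f => ?_) hW]
  · ring
  · rw [conharmonic_vbdsMetric hI hm hq hx]
    simp only [kulkarniNomizu, vbdsMetric_eq_add]
    ring

end

/-! ### The identity for R·R − Q(S, R) -/

theorem deriv4_antisymm_left {n : ℕ} (M : Fin n → Fin n → ℝ)
    {W : Fin n → Fin n → Fin n → Fin n → ℝ} (hW : ∀ b c d f, W b c d f = -W c b d f)
    (b c d f : Fin n) : deriv4 M W b c d f = -deriv4 M W c b d f := by
  simp only [deriv4, ← Finset.sum_neg_distrib]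
  refine Finset.sum_congr rfl fun a _ => ?_
  rw [hW a c, hW b a, hW b c, hW b c]
  ring

theorem deriv4_antisymm_right {n : ℕ} (M : Fin n → Fin n → ℝ)
    {W : Fin n → Fin n → Fin n → Fin n → ℝ} (hW : ∀ b c d f, W b c d f = -W b c f d)
    (b c d f : Fin n) : deriv4 M W b c d f = -deriv4 M W b c f d := by
  simp only [deriv4, ← Finset.sum_neg_distrib]
  refine Finset.sum_congr rfl fun a _ => ?_
  rw [hW a c, hW b a, hW b c a, hW b c d]
  ring

/-- A curvature-like tensor adapted to a splitting into two planes, one of them with a null frame.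
It is given by its independent components. -/
def splitTensor (u v₂ w₂ v₃ w₃ z : ℝ) : Fin 4 → Fin 4 → Fin 4 → Fin 4 → ℝ :=
  ![![0, ![![0, u, 0, 0], ![-u, 0, 0, 0], 0, 0],
      ![![0, 0, v₂, 0], ![0, 0, w₂, 0], ![-v₂, -w₂, 0, 0], 0],
      ![![0, 0, 0, v₃], ![0, 0, 0, w₃], 0, ![-v₃, -w₃, 0, 0]]],
    ![![![0, -u, 0, 0], ![u, 0, 0, 0], 0, 0], 0,
      ![![0, 0, w₂, 0], 0, ![-w₂, 0, 0, 0], 0],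
      ![![0, 0, 0, w₃], 0, 0, ![-w₃, 0, 0, 0]]],
    ![![![0, 0, -v₂, 0], ![0, 0, -w₂, 0], ![v₂, w₂, 0, 0], 0],
      ![![0, 0, -w₂, 0], 0, ![w₂, 0, 0, 0], 0], 0,
      ![0, 0, ![0, 0, 0, z], ![0, 0, -z, 0]]],
    ![![![0, 0, 0, -v₃], ![0, 0, 0, -w₃], 0, ![v₃, w₃, 0, 0]],
      ![![0, 0, 0, -w₃], 0, 0, ![w₃, 0, 0, 0]],
      ![0, 0, ![0, 0, 0, -z], ![0, 0, z, 0]], 0]]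

theorem splitTensor_antisymm_left (u v₂ w₂ v₃ w₃ z : ℝ) (b c d f : Fin 4) :
    splitTensor u v₂ w₂ v₃ w₃ z b c d f = -splitTensor u v₂ w₂ v₃ w₃ z c b d f := by
  revert b c d f
  simp [forall_fin_four, splitTensor]

theorem splitTensor_antisymm_right (u v₂ w₂ v₃ w₃ z : ℝ) (b c d f : Fin 4) :
    splitTensor u v₂ w₂ v₃ w₃ z b c d f = -splitTensor u v₂ w₂ v₃ w₃ z b c f d := by
  revert b c d f
  simp [forall_fin_four, splitTensor]

/-- Endomorphisms adapted to a splitting into two planes, one of them with a null frame, indexed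
by a pair of basis vectors. -/
noncomputable def splitOp (A ρ σ μ ν η c : ℝ) : Fin 4 → Fin 4 → Fin 4 → Fin 4 → ℝ :=
  ![![0, ![![μ, 0, 0, 0], ![μ * A - c, -μ, 0, 0], 0, 0],
      ![![0, 0, ν * ρ, 0], ![0, 0, -(c / 2 * ρ), 0], ![η * A - c / 2, -η, 0, 0], 0],
      ![![0, 0, 0, ν * σ], ![0, 0, 0, -(c / 2 * σ)], 0, ![η * A - c / 2, -η, 0, 0]]],
    ![![![-μ, 0, 0, 0], ![c - μ * A, μ, 0, 0], 0, 0], 0,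
      ![0, ![0, 0, ν * ρ, 0], ![-η, 0, 0, 0], 0],
      ![0, ![0, 0, 0, ν * σ], 0, ![-η, 0, 0, 0]]],
    ![![![0, 0, -(ν * ρ), 0], ![0, 0, c / 2 * ρ, 0], ![c / 2 - η * A, η, 0, 0], 0],
      ![0, ![0, 0, -(ν * ρ), 0], ![η, 0, 0, 0], 0], 0,
      ![0, 0, ![0, 0, 0, μ * σ], ![0, 0, -(μ * ρ), 0]]],
    ![![![0, 0, 0, -(ν * σ)], ![0, 0, 0, c / 2 * σ], 0, ![c / 2 - η * A, η, 0, 0]],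
      ![0, ![0, 0, 0, -(ν * σ)], 0, ![η, 0, 0, 0]],
      ![0, 0, ![0, 0, 0, -(μ * σ)], ![0, 0, μ * ρ, 0]], 0]]

theorem splitOp_antisymm (A ρ σ μ ν η c : ℝ) (r s a b : Fin 4) :
    splitOp A ρ σ μ ν η c r s a b = -splitOp A ρ σ μ ν η c s r a b := by
  revert r s a b
  simp [forall_fin_four, splitOp]

theorem deriv4_splitOp_antisymm (A ρ σ μ ν η e : ℝ) (W : Fin 4 → Fin 4 → Fin 4 → Fin 4 → ℝ)
    (r s b c d f : Fin 4) :
    deriv4 (splitOp A ρ σ μ ν η e r s) W b c d f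
      = -deriv4 (splitOp A ρ σ μ ν η e s r) W b c d f := by
  rw [← neg_one_mul, ← deriv4_smul_left]
  congr 1
  funext a b
  rw [splitOp_antisymm]
  ring

set_option maxHeartbeats 4000000 in
/-- The algebraic identity behind `R · R - Q(S, R) = -β Q(g, C)`. -/
theorem deriv4_splitOp_splitTensor (lam A ρ σ w e c : ℝ) (r s b₁ b₂ b₃ b₄ : Fin 4) :
    deriv4 (splitOp A ρ σ (2 * w - 2 * lam / 3) (-w - e - 2 * lam / 3) (-w + e - 2 * lam / 3) c r s)
      (splitTensor (2 * (w - e / 2 + lam / 6))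
        (((lam / 3 - w) * A + c / 2) * ρ) (-((lam / 3 - w) * ρ))
        (((lam / 3 - w) * A + c / 2) * σ) (-((lam / 3 - w) * σ))
        (-(2 * (w + e / 2 + lam / 6) * ρ * σ))) b₁ b₂ b₃ b₄
      = -((2 * lam * w + 3 * w ^ 2 - e ^ 2) / 3)
        * deriv4 (splitOp A ρ σ 1 1 1 0 r s)
          (splitTensor 2 (-(A * ρ)) ρ (-(A * σ)) σ (-(2 * ρ * σ))) b₁ b₂ b₃ b₄ := by
  revert r s
  -- Antisymmetry in (r, s), (b₃, b₄) and (b₁, b₂) leaves 6³ = 216 components.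
  refine antisymm_ext_four (fun r s => deriv4_splitOp_antisymm _ _ _ _ _ _ _ _ _ _ _ _ _ _)
    (fun r s => by rw [deriv4_splitOp_antisymm, mul_neg]) ?_ ?_ ?_ ?_ ?_ ?_ <;>
  revert b₃ b₄ <;>
  refine antisymm_ext_four
    (fun d f => deriv4_antisymm_right _ (splitTensor_antisymm_right _ _ _ _ _ _) _ _ _ _)
    (fun d f => by
      rw [deriv4_antisymm_right _ (splitTensor_antisymm_right _ _ _ _ _ _), mul_neg])
    ?_ ?_ ?_ ?_ ?_ ?_ <;>
  revert b₁ b₂ <;>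
  refine antisymm_ext_four
    (fun b c => deriv4_antisymm_left _ (splitTensor_antisymm_left _ _ _ _ _ _) _ _ _ _)
    (fun b c => by
      rw [deriv4_antisymm_left _ (splitTensor_antisymm_left _ _ _ _ _ _), mul_neg])
    ?_ ?_ ?_ ?_ ?_ ?_ <;>
  (simp only [deriv4, Fin.sum_univ_four]
   -- The tensors stay opaque while the zeros of the endomorphism remove most of the sum; only the
   -- surviving components are then unfolded.
   generalize hT : splitTensor (2 * (w - e / 2 + lam / 6)) _ _ _ _ _ = T
   generalize hC : splitTensor 2 _ _ _ _ _ = C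
   simp only [splitOp, Matrix.cons_val, Pi.zero_apply, zero_mul, add_zero, zero_add, mul_zero]
   try simp only [← hT, ← hC, splitTensor, Matrix.cons_val, Pi.zero_apply, mul_zero, add_zero,
     zero_add]
   try ring)

section

variable {lam : ℝ} {I : Set ℝ} {m q : ℝ → ℝ} {x : Pt 4}

theorem riemann_eq_splitTensor (hI : IsOpen I) (hm : DifferentiableOn ℝ m I)
    (hq : DifferentiableOn ℝ q I) (hx : x ∈ vbdsChart I) :
    riemann (vbdsMetric lam m q) x
      = splitTensor (2 * (weylScalar m q x - chargeScalar q x / 2 + lam / 6))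
        (((lam / 3 - weylScalar m q x) * lapse lam m q (x 0) (x 1) + fluxScalar m q x / 2)
          * x 1 ^ 2)
        (-((lam / 3 - weylScalar m q x) * x 1 ^ 2))
        (((lam / 3 - weylScalar m q x) * lapse lam m q (x 0) (x 1) + fluxScalar m q x / 2)
          * (x 1 ^ 2 * Real.sin (x 2) ^ 2))
        (-((lam / 3 - weylScalar m q x) * (x 1 ^ 2 * Real.sin (x 2) ^ 2)))
        (-(2 * (weylScalar m q x + chargeScalar q x / 2 + lam / 6) * x 1 ^ 2
          * (x 1 ^ 2 * Real.sin (x 2) ^ 2))) := by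
  funext b c d f
  rw [riemann_vbdsMetric_eq hI hm hq hx]
  generalize weylScalar m q x = w, chargeScalar q x = e, fluxScalar m q x = φ
  revert d f
  refine antisymm_ext_four (fun d f => ?_) (splitTensor_antisymm_right _ _ _ _ _ _ _ _)
    ?_ ?_ ?_ ?_ ?_ ?_
  · simp only [kulkarniNomizu]
    ring
  all_goals
    revert b c
    refine antisymm_ext_four (fun b c => ?_)
      (fun b c => splitTensor_antisymm_left _ _ _ _ _ _ _ _ _ _) ?_ ?_ ?_ ?_ ?_ ?_
    · simp only [kulkarniNomizu]
      ring
    all_goals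
      simp [splitTensor, kulkarniNomizu, vbdsRadial, vbdsAngular, nullSquare]
      try ring

theorem weyl_eq_splitTensor (hI : IsOpen I) (hm : DifferentiableOn ℝ m I)
    (hq : DifferentiableOn ℝ q I) (hx : x ∈ vbdsChart I) (b c d f : Fin 4) :
    weyl (vbdsMetric lam m q) x b c d f
      = weylScalar m q x * splitTensor 2 (-(lapse lam m q (x 0) (x 1) * x 1 ^ 2)) (x 1 ^ 2)
        (-(lapse lam m q (x 0) (x 1) * (x 1 ^ 2 * Real.sin (x 2) ^ 2)))
        (x 1 ^ 2 * Real.sin (x 2) ^ 2)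
        (-(2 * x 1 ^ 2 * (x 1 ^ 2 * Real.sin (x 2) ^ 2))) b c d f := by
  rw [weyl_vbdsMetric hI hm hq hx]
  congr 1
  revert d f
  refine antisymm_ext_four (fun d f => ?_) (splitTensor_antisymm_right _ _ _ _ _ _ _ _)
    ?_ ?_ ?_ ?_ ?_ ?_
  · simp only [kulkarniNomizu]
    ring
  all_goals
    revert b c
    refine antisymm_ext_four (fun b c => ?_)
      (fun b c => splitTensor_antisymm_left _ _ _ _ _ _ _ _ _ _) ?_ ?_ ?_ ?_ ?_ ?_
    · simp only [kulkarniNomizu]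
      ring
    all_goals
      simp [splitTensor, kulkarniNomizu, vbdsRadial, vbdsAngular]
      try ring

/-- R·R is minus the action of the raised curvature, and Q(S, R) is plus the action of the
endomorphisms built from S. Hence R·R − Q(S, R) is minus the action of this sum on R. -/
theorem raiseFirst_riemann_add_ricci (hI : IsOpen I) (hm : DifferentiableOn ℝ m I)
    (hq : DifferentiableOn ℝ q I) (hx : x ∈ vbdsChart I) (a b r s : Fin 4) :
    raiseFirst (vbdsMetric lam m q) (riemann (vbdsMetric lam m q)) x a b r s
        + ((if a = r then ricci (vbdsMetric lam m q) x s b else 0)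
          - (if a = s then ricci (vbdsMetric lam m q) x r b else 0))
      = splitOp (lapse lam m q (x 0) (x 1)) (x 1 ^ 2) (x 1 ^ 2 * Real.sin (x 2) ^ 2)
        (2 * weylScalar m q x - 2 * lam / 3) (-weylScalar m q x - chargeScalar q x - 2 * lam / 3)
        (-weylScalar m q x + chargeScalar q x - 2 * lam / 3) (fluxScalar m q x) r s a b := by
  obtain ⟨-, h1, h2⟩ := id hx
  revert r s
  refine antisymm_ext_four (fun r s => ?_) (fun r s => splitOp_antisymm _ _ _ _ _ _ _ _ _ _ _)
    ?_ ?_ ?_ ?_ ?_ ?_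
  · have : ∀ r s, raiseFirst (vbdsMetric lam m q) (riemann (vbdsMetric lam m q)) x a b r s
        = -raiseFirst (vbdsMetric lam m q) (riemann (vbdsMetric lam m q)) x a b s r := fun r s => by
      simp only [raiseFirst, ← Finset.sum_neg_distrib]
      exact Finset.sum_congr rfl fun e _ => by rw [riemann_antisymm, mul_neg]
    rw [this]
    ring
  all_goals
    simp only [raiseFirst, riemann_eq_splitTensor hI hm hq hx, inverseMetric_vbdsMetric h1 h2,
      Matrix.of_apply, Fin.sum_univ_four, ricci_vbdsMetric hI hm hq hx]
    generalize weylScalar m q x = w, chargeScalar q x = e, fluxScalar m q x = φ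
    revert a b
    simp only [forall_fin_four]
    refine ⟨⟨?_, ?_, ?_, ?_⟩, ⟨?_, ?_, ?_, ?_⟩, ⟨?_, ?_, ?_, ?_⟩, ?_, ?_, ?_, ?_⟩ <;>
    (simp [splitOp, splitTensor, vbdsInverse, vbdsRadial, vbdsAngular, nullSquare]
     try field_simp
     try ring)

/-- At these parameters the family acts as −Q(g, ·), which identifies the right side of
`deriv4_splitOp_splitTensor` with a multiple of Q(g, C/w). -/
theorem splitOp_one_eq_metric (r s a b : Fin 4) :
    splitOp (lapse lam m q (x 0) (x 1)) (x 1 ^ 2) (x 1 ^ 2 * Real.sin (x 2) ^ 2) 1 1 1 0 r s a b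
      = -((if a = r then vbdsMetric lam m q x s b else 0)
        - (if a = s then vbdsMetric lam m q x r b else 0)) := by
  revert r s a b
  simp [forall_fin_four, splitOp, vbdsMetric_apply]

/-- As C is w times a fixed pattern, β enters only through βw, and the condition on it is stated
without division. -/
theorem curvDot_riemann_riemann (hI : IsOpen I) (hm : DifferentiableOn ℝ m I)
    (hq : DifferentiableOn ℝ q I) (hx : x ∈ vbdsChart I) (β : ℝ)
    (hβ : β * weylScalar m q x = (2 * lam * weylScalar m q x + 3 * weylScalar m q x ^ 2
      - chargeScalar q x ^ 2) / 3) (a b c d r s : Fin 4) :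
    curvDot (vbdsMetric lam m q) (riemann (vbdsMetric lam m q)) (riemann (vbdsMetric lam m q))
        x a b c d r s
        + β * tachibana (vbdsMetric lam m q) (weyl (vbdsMetric lam m q)) x a b c d r s
      = tachibana (ricci (vbdsMetric lam m q)) (riemann (vbdsMetric lam m q)) x a b c d r s := by
  have hW : weyl (vbdsMetric lam m q) x = _ := funext fun b => funext fun c => funext fun d =>
    funext fun f => weyl_eq_splitTensor hI hm hq hx b c d f
  have hN := deriv4_splitOp_splitTensor lam (lapse lam m q (x 0) (x 1)) (x 1 ^ 2)
    (x 1 ^ 2 * Real.sin (x 2) ^ 2) (weylScalar m q x) (chargeScalar q x) (fluxScalar m q x)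
    r s a b c d
  rw [← riemann_eq_splitTensor hI hm hq hx,
    show splitOp _ _ _ _ _ _ _ r s = _ from funext fun a => funext fun b =>
      (raiseFirst_riemann_add_ricci hI hm hq hx a b r s).symm, deriv4_add_left,
    show splitOp _ _ _ 1 1 1 0 r s = fun a b =>
      -1 * ((if a = r then vbdsMetric lam m q x s b else 0)
        - (if a = s then vbdsMetric lam m q x r b else 0)) from funext fun a => funext fun b =>
      (splitOp_one_eq_metric r s a b).trans (neg_one_mul _).symm, deriv4_smul_left] at hN
  rw [curvDot_eq_deriv4, tachibana_eq_deriv4, tachibana_eq_deriv4, hW, deriv4_smul_right,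
    ← mul_assoc, hβ]
  linear_combination -hN

end

/-! ### Recurrence of the conformal 2-forms -/

theorem pd_splitTensor (i : Fin 4) (u v₂ w₂ v₃ w₃ z : Pt 4 → ℝ) (x : Pt 4) (b c d f : Fin 4) :
    pd i (fun y => splitTensor (u y) (v₂ y) (w₂ y) (v₃ y) (w₃ y) (z y) b c d f) x
      = splitTensor (pd i u x) (pd i v₂ x) (pd i w₂ x) (pd i v₃ x) (pd i w₃ x) (pd i z x)
        b c d f := by
  revert b c d f
  simp [forall_fin_four, splitTensor, pd_neg, pd_const]

theorem smul_splitTensor (k u v₂ w₂ v₃ w₃ z : ℝ) (b c d f : Fin 4) :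
    k * splitTensor u v₂ w₂ v₃ w₃ z b c d f
      = splitTensor (k * u) (k * v₂) (k * w₂) (k * v₃) (k * w₃) (k * z) b c d f := by
  revert b c d f
  simp [forall_fin_four, splitTensor]

/-- The derivative of the coefficient of the Weyl tensor in `t`. -/
noncomputable def weylScalarT (m q : ℝ → ℝ) (t r : ℝ) : ℝ :=
  (r * deriv m t - 2 * q t * deriv q t) / r ^ 4

/-- The derivative of the coefficient of the Weyl tensor in `r`. -/
noncomputable def weylScalarR (m q : ℝ → ℝ) (t r : ℝ) : ℝ :=
  -3 * m t / r ^ 4 + 4 * q t ^ 2 / r ^ 5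

theorem hasDerivAt_weylScalar_left {m q : ℝ → ℝ} {t r : ℝ} (hm : DifferentiableAt ℝ m t)
    (hq : DifferentiableAt ℝ q t) :
    HasDerivAt (fun s => (r * m s - q s ^ 2) / r ^ 4) (weylScalarT m q t r) t := by
  refine (((hm.hasDerivAt.const_mul r).sub (hq.hasDerivAt.pow 2)).div_const (r ^ 4)).congr_deriv ?_
  simp [weylScalarT]

theorem hasDerivAt_weylScalar_right {m q : ℝ → ℝ} {t r : ℝ} (hr : r ≠ 0) :
    HasDerivAt (fun s => (s * m t - q t ^ 2) / s ^ 4) (weylScalarR m q t r) r := by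
  refine ((((hasDerivAt_id r).mul_const (m t)).sub_const (q t ^ 2)).div (hasDerivAt_pow 4 r)
    (pow_ne_zero 4 hr)).congr_deriv ?_
  simp [weylScalarR]
  field_simp
  ring

section

variable {lam : ℝ} {I : Set ℝ} {m q : ℝ → ℝ} {x : Pt 4}

theorem pd_weyl (hI : IsOpen I) (hm : DifferentiableOn ℝ m I)
    (hq : DifferentiableOn ℝ q I) (hx : x ∈ vbdsChart I) (i b c d f : Fin 4) :
    pd i (fun y => weyl (vbdsMetric lam m q) y b c d f) x
      = (![splitTensor (2 * weylScalarT m q (x 0) (x 1))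
          (-((weylScalarT m q (x 0) (x 1) * lapse lam m q (x 0) (x 1)
            + weylScalar m q x * lapseT m q (x 0) (x 1)) * x 1 ^ 2))
          (weylScalarT m q (x 0) (x 1) * x 1 ^ 2)
          (-((weylScalarT m q (x 0) (x 1) * lapse lam m q (x 0) (x 1)
            + weylScalar m q x * lapseT m q (x 0) (x 1)) * x 1 ^ 2 * Real.sin (x 2) ^ 2))
          (weylScalarT m q (x 0) (x 1) * x 1 ^ 2 * Real.sin (x 2) ^ 2)
          (-(2 * weylScalarT m q (x 0) (x 1) * x 1 ^ 4 * Real.sin (x 2) ^ 2)),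
        splitTensor (2 * weylScalarR m q (x 0) (x 1))
          (-((weylScalarR m q (x 0) (x 1) * lapse lam m q (x 0) (x 1)
            + weylScalar m q x * lapseR lam m q (x 0) (x 1)) * x 1 ^ 2
            + weylScalar m q x * lapse lam m q (x 0) (x 1) * (2 * x 1)))
          (weylScalarR m q (x 0) (x 1) * x 1 ^ 2 + weylScalar m q x * (2 * x 1))
          (-(((weylScalarR m q (x 0) (x 1) * lapse lam m q (x 0) (x 1)
            + weylScalar m q x * lapseR lam m q (x 0) (x 1)) * x 1 ^ 2
            + weylScalar m q x * lapse lam m q (x 0) (x 1) * (2 * x 1)) * Real.sin (x 2) ^ 2))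
          ((weylScalarR m q (x 0) (x 1) * x 1 ^ 2 + weylScalar m q x * (2 * x 1))
            * Real.sin (x 2) ^ 2)
          (-(2 * (weylScalarR m q (x 0) (x 1) * x 1 ^ 4 + weylScalar m q x * (4 * x 1 ^ 3))
            * Real.sin (x 2) ^ 2)),
        splitTensor 0 0 0
          (-(weylScalar m q x * lapse lam m q (x 0) (x 1) * x 1 ^ 2
            * (2 * Real.sin (x 2) * Real.cos (x 2))))
          (weylScalar m q x * x 1 ^ 2 * (2 * Real.sin (x 2) * Real.cos (x 2)))
          (-(2 * weylScalar m q x * x 1 ^ 4 * (2 * Real.sin (x 2) * Real.cos (x 2)))),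
        0] : Fin 4 → Fin 4 → Fin 4 → Fin 4 → Fin 4 → ℝ) i b c d f := by
  have hw : ∀ y ∈ vbdsChart I, weyl (vbdsMetric lam m q) y b c d f
      = splitTensor (2 * ((y 1 * m (y 0) - q (y 0) ^ 2) / y 1 ^ 4))
        (-((y 1 * m (y 0) - q (y 0) ^ 2) / y 1 ^ 4 * lapse lam m q (y 0) (y 1) * y 1 ^ 2))
        ((y 1 * m (y 0) - q (y 0) ^ 2) / y 1 ^ 4 * y 1 ^ 2)
        (-((y 1 * m (y 0) - q (y 0) ^ 2) / y 1 ^ 4 * lapse lam m q (y 0) (y 1) * y 1 ^ 2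
          * Real.sin (y 2) ^ 2))
        ((y 1 * m (y 0) - q (y 0) ^ 2) / y 1 ^ 4 * y 1 ^ 2 * Real.sin (y 2) ^ 2)
        (-(2 * ((y 1 * m (y 0) - q (y 0) ^ 2) / y 1 ^ 4) * y 1 ^ 4 * Real.sin (y 2) ^ 2))
        b c d f := fun y hy => by
    rw [weyl_eq_splitTensor hI hm hq hy, smul_splitTensor, weylScalar]
    congr 1 <;> ring
  rw [pd_congr (isOpen_vbdsChart hI) hw hx i, pd_splitTensor]
  obtain ⟨h0, h1, h2⟩ := hx
  replace hm := hm.differentiableAt (hI.mem_nhds h0)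
  replace hq := hq.differentiableAt (hI.mem_nhds h0)
  have wt := hasDerivAt_weylScalar_left (r := x 1) hm hq
  have wr := hasDerivAt_weylScalar_right (m := m) (q := q) (t := x 0) h1
  have at' := hasDerivAt_lapse_left (lam := lam) (r := x 1) hm hq
  have ar := hasDerivAt_lapse_right (lam := lam) (m := m) (q := q) (t := x 0) h1
  have r2 : HasDerivAt (fun r : ℝ => r ^ 2) (2 * x 1) (x 1) := by simpa using hasDerivAt_pow 2 (x 1)
  have r4 : HasDerivAt (fun r : ℝ => r ^ 4) (4 * x 1 ^ 3) (x 1) := by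
    simpa using hasDerivAt_pow 4 (x 1)
  have ss : HasDerivAt (fun s => Real.sin s ^ 2) (2 * Real.sin (x 2) * Real.cos (x 2)) (x 2) :=
    ((Real.hasDerivAt_sin (x 2)).pow 2).congr_deriv (by simp)
  let F0 : ℝ → ℝ → ℝ → ℝ := fun t r _ => 2 * ((r * m t - q t ^ 2) / r ^ 4)
  let F1 : ℝ → ℝ → ℝ → ℝ := fun t r _ => -((r * m t - q t ^ 2) / r ^ 4 * lapse lam m q t r * r ^ 2)
  let F2 : ℝ → ℝ → ℝ → ℝ := fun t r _ => (r * m t - q t ^ 2) / r ^ 4 * r ^ 2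
  let F3 : ℝ → ℝ → ℝ → ℝ := fun t r s =>
    -((r * m t - q t ^ 2) / r ^ 4 * lapse lam m q t r * r ^ 2 * Real.sin s ^ 2)
  let F4 : ℝ → ℝ → ℝ → ℝ := fun t r s => (r * m t - q t ^ 2) / r ^ 4 * r ^ 2 * Real.sin s ^ 2
  let F5 : ℝ → ℝ → ℝ → ℝ := fun t r s =>
    -(2 * ((r * m t - q t ^ 2) / r ^ 4) * r ^ 4 * Real.sin s ^ 2)
  revert i
  rw [forall_fin_four]
  refine ⟨?_, ?_, ?_, ?_⟩
  · rw [pd_zero_eq (F := F0) (wt.const_mul 2),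
      pd_zero_eq (F := F1) (((wt.mul at').mul_const (x 1 ^ 2)).neg),
      pd_zero_eq (F := F2) (wt.mul_const (x 1 ^ 2)),
      pd_zero_eq (F := F3)
        ((((wt.mul at').mul_const (x 1 ^ 2)).mul_const (Real.sin (x 2) ^ 2)).neg),
      pd_zero_eq (F := F4) ((wt.mul_const (x 1 ^ 2)).mul_const (Real.sin (x 2) ^ 2)),
      pd_zero_eq (F := F5)
        ((((wt.const_mul 2).mul_const (x 1 ^ 4)).mul_const (Real.sin (x 2) ^ 2)).neg)]
    rfl
  · rw [pd_one_eq (F := F0) (wr.const_mul 2),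
      pd_one_eq (F := F1) (((wr.mul ar).mul r2).neg),
      pd_one_eq (F := F2) (wr.mul r2),
      pd_one_eq (F := F3) ((((wr.mul ar).mul r2).mul_const (Real.sin (x 2) ^ 2)).neg),
      pd_one_eq (F := F4) ((wr.mul r2).mul_const (Real.sin (x 2) ^ 2)),
      pd_one_eq (F := F5) ((((wr.const_mul 2).mul r4).mul_const (Real.sin (x 2) ^ 2)).neg)]
    simp only [weylScalar]
    refine congrFun (congrFun (congrFun (congrFun
      (?_ : splitTensor _ _ _ _ _ _ = splitTensor _ _ _ _ _ _) b) c) d) f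
    congr 1
    ring
  · rw [pd_two_eq (F := F0) (hasDerivAt_const _ _),
      pd_two_eq (F := F1) (hasDerivAt_const _ _),
      pd_two_eq (F := F2) (hasDerivAt_const _ _),
      pd_two_eq (F := F3) ((ss.const_mul _).neg),
      pd_two_eq (F := F4) (ss.const_mul _),
      pd_two_eq (F := F5) ((ss.const_mul _).neg)]
    rfl
  · rw [pd_three_eq F0,
      pd_three_eq F1,
      pd_three_eq F2,
      pd_three_eq F3,
      pd_three_eq F4,
      pd_three_eq F5]
    revert b c d f
    simp [forall_fin_four, splitTensor]

end

theorem covDeriv_antisymm_left {n : ℕ} {g : Cov2 n} {W : Cov4 n} {U : Set (Pt n)}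
    (hU : IsOpen U) (hW : ∀ y ∈ U, ∀ b c d f, W y b c d f = -W y c b d f)
    {x : Pt n} (hx : x ∈ U) (e f s t d : Fin n) :
    covDeriv g W x e f s t d = -covDeriv g W x e s f t d := by
  have h1 : pd e (fun y => W y f s t d) x = -pd e (fun y => W y s f t d) x := by
    rw [pd_congr hU (fun y hy => hW y hy f s t d) hx, pd_neg]
  simp only [covDeriv, h1, sub_eq_add_neg, neg_add, neg_neg,
    ← Finset.sum_neg_distrib]
  congr 1
  refine Finset.sum_congr rfl fun a _ => ?_
  rw [hW x hx a s, hW x hx f a, hW x hx f s, hW x hx f s]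
  ring

theorem covDeriv_antisymm_right {n : ℕ} {g : Cov2 n} {W : Cov4 n} {U : Set (Pt n)}
    (hU : IsOpen U) (hW : ∀ y ∈ U, ∀ b c d f, W y b c d f = -W y b c f d)
    {x : Pt n} (hx : x ∈ U) (e f s t d : Fin n) :
    covDeriv g W x e f s t d = -covDeriv g W x e f s d t := by
  have h1 : pd e (fun y => W y f s t d) x = -pd e (fun y => W y f s d t) x := by
    rw [pd_congr hU (fun y hy => hW y hy f s t d) hx, pd_neg]
  simp only [covDeriv, h1, sub_eq_add_neg, neg_add, neg_neg,
    ← Finset.sum_neg_distrib]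
  congr 1
  refine Finset.sum_congr rfl fun a _ => ?_
  rw [hW x hx a s, hW x hx f a, hW x hx f s a, hW x hx f s t]
  ring

section

variable {lam : ℝ} {I : Set ℝ} {m q : ℝ → ℝ} {x : Pt 4}

set_option maxHeartbeats 4000000 in
-- Write C = wT with T = g₁∧g₁ − g₁∧g₂ + g₂∧g₂. The cyclic sum of ∇T equals that of (3/r) dr ⊗ T, so
-- the product rule leaves dw + (3w/r) dr acting on T. The hypothesis on `P` says that Pw is this
-- 1-form.
theorem recurrent_weyl (hI : IsOpen I) (hm : DifferentiableOn ℝ m I)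
    (hq : DifferentiableOn ℝ q I) (hx : x ∈ vbdsChart I) {P : Fin 4 → ℝ}
    (hP : ∀ e, P e * weylScalar m q x = ![weylScalarT m q (x 0) (x 1),
      weylScalarR m q (x 0) (x 1) + 3 * weylScalar m q x / x 1, 0, 0] e)
    (e f s t d : Fin 4) :
    covDeriv (vbdsMetric lam m q) (weyl (vbdsMetric lam m q)) x e f s t d
        + covDeriv (vbdsMetric lam m q) (weyl (vbdsMetric lam m q)) x f s e t d
        + covDeriv (vbdsMetric lam m q) (weyl (vbdsMetric lam m q)) x s e f t d
      = P e * weyl (vbdsMetric lam m q) x f s t d + P f * weyl (vbdsMetric lam m q) x s e t d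
        + P s * weyl (vbdsMetric lam m q) x e f t d := by
  obtain ⟨h0, h1, h2⟩ := id hx
  have hm' := hm.differentiableAt (hI.mem_nhds h0)
  have hq' := hq.differentiableAt (hI.mem_nhds h0)
  have hWl : ∀ y ∈ vbdsChart I, ∀ b c d f, weyl (vbdsMetric lam m q) y b c d f
      = -weyl (vbdsMetric lam m q) y c b d f := fun y hy b c d f => by
    rw [weyl_eq_splitTensor hI hm hq hy, weyl_eq_splitTensor hI hm hq hy,
      splitTensor_antisymm_left, mul_neg]
  have hWr : ∀ y ∈ vbdsChart I, ∀ b c d f, weyl (vbdsMetric lam m q) y b c d f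
      = -weyl (vbdsMetric lam m q) y b c f d := fun y hy b c d f => by
    rw [weyl_eq_splitTensor hI hm hq hy, weyl_eq_splitTensor hI hm hq hy,
      splitTensor_antisymm_right, mul_neg]
  have hU := isOpen_vbdsChart hI
  revert t d
  refine antisymm_ext_four (fun t d => ?_) (fun t d => ?_) ?_ ?_ ?_ ?_ ?_ ?_
  · rw [covDeriv_antisymm_right hU hWr hx, covDeriv_antisymm_right hU hWr hx f,
      covDeriv_antisymm_right hU hWr hx s]
    ring
  · rw [hWr x hx f s, hWr x hx s e, hWr x hx e f]
    ring
  all_goals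
    revert e f s
    refine antisymm_ext_four_three (fun e f s => ?_) (fun e f s => ?_) (fun e f s => by ring)
      (fun e f s => by ring) ?_ ?_ ?_ ?_
    · rw [covDeriv_antisymm_left hU hWl hx, covDeriv_antisymm_left hU hWl hx f,
        covDeriv_antisymm_left hU hWl hx s]
      ring
    · rw [hWl x hx f s, hWl x hx s e, hWl x hx e f]
      ring
  all_goals
    simp only [covDeriv, pd_weyl hI hm hq hx, christoffel_vbdsMetric hm' hq' h1 h2,
      weyl_eq_splitTensor hI hm hq hx, ← mul_assoc, hP, Fin.sum_univ_four]
    clear hP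
    -- From here w and its two derivatives are independent variables: the identity depends only on
    -- the geometry of T.
    generalize weylScalar m q x = w, weylScalarT m q (x 0) (x 1) = wt,
      weylScalarR m q (x 0) (x 1) = wr
    simp [splitTensor, vbdsChristoffel]
    try field_simp
    try ring

end

/-! ### Ricci compatibility for a general metric -/

section Compatibility

variable {n : ℕ} {g : Cov2 n} {x : Pt n}

theorem inverseMetric_symm (hs : ∀ i j, g x i j = g x j i) (i j : Fin n) :
    inverseMetric g x i j = inverseMetric g x j i := by
  have : (Matrix.of (g x)).transpose = Matrix.of (g x) := by
    ext i j
    exact hs j i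
  rw [inverseMetric, ← Matrix.transpose_apply (Matrix.of (g x))⁻¹, Matrix.transpose_nonsing_inv,
    this]

theorem sum_ricciOp_mul_metric (h : IsUnit (Matrix.of (g x)).det)
    (hS : ∀ i j, ricci g x i j = ricci g x j i) (e f : Fin n) :
    ∑ d, ricciOp g x d e * g x f d = ricci g x e f := by
  have h' : ∀ a, ∑ d, g x f d * inverseMetric g x d a = if f = a then 1 else 0 := fun a => by
    have := congrFun (congrFun (Matrix.mul_nonsing_inv _ h) f) a
    rwa [Matrix.mul_apply, Matrix.one_apply] at this
  calc ∑ d, ricciOp g x d e * g x f d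
      = ∑ a, (∑ d, g x f d * inverseMetric g x d a) * ricci g x a e := by
        simp only [ricciOp, Finset.sum_mul]
        rw [Finset.sum_comm]
        exact Finset.sum_congr rfl fun _ _ => Finset.sum_congr rfl fun _ _ => by ring
    _ = ricci g x e f := by
        simp only [h', ite_mul, one_mul, zero_mul, Finset.sum_ite_eq, Finset.mem_univ, if_true]
        exact hS f e

theorem sum_ricciOp_mul_ricci_symm (hs : ∀ i j, g x i j = g x j i)
    (hS : ∀ i j, ricci g x i j = ricci g x j i) (e f : Fin n) :
    ∑ d, ricciOp g x d e * ricci g x f d = ∑ d, ricciOp g x d f * ricci g x e d := by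
  simp only [ricciOp, Finset.sum_mul]
  rw [Finset.sum_comm]
  refine Finset.sum_congr rfl fun d _ => Finset.sum_congr rfl fun a _ => ?_
  rw [inverseMetric_symm hs, hS f a, hS d e]
  ring

/-- Ricci compatibility is not affected by adding tensors built from the metric and the Ricci
tensor. -/
theorem ricciCompatible_add (h : IsUnit (Matrix.of (g x)).det) (hs : ∀ i j, g x i j = g x j i)
    (hS : ∀ i j, ricci g x i j = ricci g x j i) {R W : Cov4 n}
    (hR : ∀ e f s t, ∑ d, (ricciOp g x d e * R x f s t d + ricciOp g x d f * R x s e t d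
      + ricciOp g x d s * R x e f t d) = 0) (α β γ : ℝ)
    (hW : ∀ b c d f, W x b c d f = R x b c d f + α * kulkarniNomizu g g x b c d f
      + β * kulkarniNomizu g (ricci g) x b c d f
      + γ * (g x b f * ricci g x c d - g x c f * ricci g x b d)) (e f s t : Fin n) :
    ∑ d, (ricciOp g x d e * W x f s t d + ricciOp g x d f * W x s e t d
      + ricciOp g x d s * W x e f t d) = 0 := by
  -- Contracting with the Ricci operator turns g into S and S into S². Both are symmetric, so each
  -- added term has a partner of opposite sign in the cyclic sum.
  have key : ∀ e f s, ∑ d, ricciOp g x d e * W x f s t d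
      = ∑ d, ricciOp g x d e * R x f s t d
        + 2 * α * (ricci g x e f * g x s t - ricci g x e s * g x f t)
        + β * (ricci g x e f * ricci g x s t - ricci g x e s * ricci g x f t
          + g x s t * ∑ d, ricciOp g x d e * ricci g x f d
          - g x f t * ∑ d, ricciOp g x d e * ricci g x s d)
        + γ * (ricci g x e f * ricci g x s t - ricci g x e s * ricci g x f t) := by
    intro e f s
    simp only [← sum_ricciOp_mul_metric h hS e, hW, kulkarniNomizu, Finset.mul_sum,
      Finset.sum_mul, ← Finset.sum_add_distrib, ← Finset.sum_sub_distrib]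
    exact Finset.sum_congr rfl fun d _ => by ring
  have hR' := hR e f s t
  simp only [Finset.sum_add_distrib] at hR' ⊢
  rw [key, key, key, sum_ricciOp_mul_ricci_symm hs hS f e, sum_ricciOp_mul_ricci_symm hs hS s e,
    sum_ricciOp_mul_ricci_symm hs hS s f, hS f e, hS s e, hS s f]
  linear_combination hR'

end Compatibility

/-! ### Ricci operator and its powers; compatibility and Roter type -/

section

variable {lam : ℝ} {I : Set ℝ} {m q : ℝ → ℝ} {x : Pt 4}

theorem ricci_vbdsMetric_symm (hI : IsOpen I) (hm : DifferentiableOn ℝ m I)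
    (hq : DifferentiableOn ℝ q I) (hx : x ∈ vbdsChart I) (i j : Fin 4) :
    ricci (vbdsMetric lam m q) x i j = ricci (vbdsMetric lam m q) x j i := by
  simp only [ricci_vbdsMetric hI hm hq hx]
  revert i j
  simp [forall_fin_four, vbdsRadial, vbdsAngular, nullSquare]

theorem ricciOp_vbdsMetric (hI : IsOpen I) (hm : DifferentiableOn ℝ m I)
    (hq : DifferentiableOn ℝ q I) (hx : x ∈ vbdsChart I) (d e : Fin 4) :
    ricciOp (vbdsMetric lam m q) x d e
      = (![![lam - chargeScalar q x, 0, 0, 0],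
          ![-fluxScalar m q x, lam - chargeScalar q x, 0, 0],
          ![0, 0, lam + chargeScalar q x, 0],
          ![0, 0, 0, lam + chargeScalar q x]] : Fin 4 → Fin 4 → ℝ) d e := by
  obtain ⟨-, h1, h2⟩ := id hx
  simp only [ricciOp, ricci_vbdsMetric hI hm hq hx, inverseMetric_vbdsMetric h1 h2,
    Matrix.of_apply, Fin.sum_univ_four]
  revert d e
  simp only [forall_fin_four]
  refine ⟨⟨?_, ?_, ?_, ?_⟩, ⟨?_, ?_, ?_, ?_⟩, ⟨?_, ?_, ?_, ?_⟩, ?_, ?_, ?_, ?_⟩ <;>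
  (simp [vbdsInverse, vbdsRadial, vbdsAngular, nullSquare]; try field_simp
   try ring)

theorem ricciCompatible_riemann (hI : IsOpen I) (hm : DifferentiableOn ℝ m I)
    (hq : DifferentiableOn ℝ q I) (hx : x ∈ vbdsChart I) (e f s t : Fin 4) :
    ∑ d, (ricciOp (vbdsMetric lam m q) x d e * riemann (vbdsMetric lam m q) x f s t d
      + ricciOp (vbdsMetric lam m q) x d f * riemann (vbdsMetric lam m q) x s e t d
      + ricciOp (vbdsMetric lam m q) x d s * riemann (vbdsMetric lam m q) x e f t d) = 0 := by
  simp only [ricciOp_vbdsMetric hI hm hq hx, riemann_eq_splitTensor hI hm hq hx]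
  -- The values of the curvature components are irrelevant: their zero pattern and the block form of
  -- the Ricci operator suffice.
  generalize 2 * (weylScalar m q x - chargeScalar q x / 2 + lam / 6) = u,
    ((lam / 3 - weylScalar m q x) * lapse lam m q (x 0) (x 1) + fluxScalar m q x / 2) = v,
    lam / 3 - weylScalar m q x = w,
    -(2 * (weylScalar m q x + chargeScalar q x / 2 + lam / 6) * x 1 ^ 2
          * (x 1 ^ 2 * Real.sin (x 2) ^ 2)) = z
  revert e f s
  refine antisymm_ext_four_three (G := fun _ _ _ => 0) (fun e f s => ?_) (by simp)
    (fun e f s => Finset.sum_congr rfl fun d _ => by ring) (by simp) ?_ ?_ ?_ ?_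
  · rw [← Finset.sum_neg_distrib]
    refine Finset.sum_congr rfl fun d _ => ?_
    rw [splitTensor_antisymm_left _ _ _ _ _ _ f s, splitTensor_antisymm_left _ _ _ _ _ _ s e,
      splitTensor_antisymm_left _ _ _ _ _ _ e f]
    ring
  all_goals
    simp only [Fin.sum_univ_four]
    revert t
    simp [forall_fin_four, splitTensor]

/-- On the radial plane the Ricci operator is a + N with a = λ − e and N² = 0. Its k-th power is
therefore a^k + k a^(k−1) N, which accounts for the coefficients of dt² here and for k = 3. -/
theorem ricciPow_two_vbdsMetric (hI : IsOpen I) (hm : DifferentiableOn ℝ m I)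
    (hq : DifferentiableOn ℝ q I) (hx : x ∈ vbdsChart I) (i j : Fin 4) :
    ricciPow (vbdsMetric lam m q) 2 x i j
      = (lam - chargeScalar q x) ^ 2 * vbdsRadial lam m q x i j
        + (lam + chargeScalar q x) ^ 2 * vbdsAngular x i j
        + 2 * (lam - chargeScalar q x) * fluxScalar m q x * nullSquare x i j := by
  simp only [ricciPow, ricciOp_vbdsMetric hI hm hq hx, ricci_vbdsMetric hI hm hq hx,
    Fin.sum_univ_four]
  revert i j
  simp only [forall_fin_four]
  refine ⟨⟨?_, ?_, ?_, ?_⟩, ⟨?_, ?_, ?_, ?_⟩, ⟨?_, ?_, ?_, ?_⟩, ?_, ?_, ?_, ?_⟩ <;>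
  (simp [vbdsRadial, vbdsAngular, nullSquare]; try ring)

theorem ricciPow_three_vbdsMetric (hI : IsOpen I) (hm : DifferentiableOn ℝ m I)
    (hq : DifferentiableOn ℝ q I) (hx : x ∈ vbdsChart I) (i j : Fin 4) :
    ricciPow (vbdsMetric lam m q) 3 x i j
      = (lam - chargeScalar q x) ^ 3 * vbdsRadial lam m q x i j
        + (lam + chargeScalar q x) ^ 3 * vbdsAngular x i j
        + 3 * (lam - chargeScalar q x) ^ 2 * fluxScalar m q x * nullSquare x i j := by
  rw [ricciPow]
  simp only [ricciOp_vbdsMetric hI hm hq hx, ricciPow_two_vbdsMetric hI hm hq hx,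
    Fin.sum_univ_four]
  revert i j
  simp only [forall_fin_four]
  refine ⟨⟨?_, ?_, ?_, ?_⟩, ⟨?_, ?_, ?_, ?_⟩, ⟨?_, ?_, ?_, ?_⟩, ?_, ?_, ?_, ?_⟩ <;>
  (simp [vbdsRadial, vbdsAngular, nullSquare]; try ring)

/-- Put k = e and a = λ − k. Then S² − 2aS + a²g = 4k² g₂, that is, g₂ = X S² + Y S + Z g. Replacing
g₁ by g − g₂ and φ dt² by S − a g − 2k g₂ turns R into (w − k/2 + λ/6) g∧g + G g∧g₂ + E g₂∧g₂ + ½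
g₂∧S; expanding g₂ yields the stated coefficients. -/
theorem riemann_roter (hI : IsOpen I) (hm : DifferentiableOn ℝ m I)
    (hq : DifferentiableOn ℝ q I) (hx : x ∈ vbdsChart I) (hc : chargeScalar q x ≠ 0)
    {w k a G E X Y Z : ℝ} (hw : w = weylScalar m q x) (hk : k = chargeScalar q x)
    (ha : a = lam - k) (hG : G = -3 * w + 3 * k / 2 - lam / 2) (hE : E = 3 * w - k)
    (hX : X = 1 / (4 * k ^ 2)) (hY : Y = -2 * a * X) (hZ : Z = a ^ 2 * X) (e f s t : Fin 4) :
    riemann (vbdsMetric lam m q) x e f s t =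
      (w - k / 2 + lam / 6 + G * Z + E * Z ^ 2)
        * kulkarniNomizu (vbdsMetric lam m q) (vbdsMetric lam m q) x e f s t
      + (G * Y + 2 * E * Y * Z + Z / 2)
        * kulkarniNomizu (vbdsMetric lam m q) (ricci (vbdsMetric lam m q)) x e f s t
      + (E * Y ^ 2 + Y / 2)
        * kulkarniNomizu (ricci (vbdsMetric lam m q)) (ricci (vbdsMetric lam m q)) x e f s t
      + (G * X + 2 * E * X * Z)
        * kulkarniNomizu (vbdsMetric lam m q) (ricciPow (vbdsMetric lam m q) 2) x e f s t
      + (2 * E * X * Y + X / 2) * kulkarniNomizu (ricci (vbdsMetric lam m q))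
          (ricciPow (vbdsMetric lam m q) 2) x e f s t
      + E * X ^ 2 * kulkarniNomizu (ricciPow (vbdsMetric lam m q) 2)
          (ricciPow (vbdsMetric lam m q) 2) x e f s t := by
  rw [← hk] at hc
  have hH : ∀ i j, vbdsAngular x i j = X * ricciPow (vbdsMetric lam m q) 2 x i j
      + Y * ricci (vbdsMetric lam m q) x i j + Z * vbdsMetric lam m q x i j := fun i j => by
    rw [ricciPow_two_vbdsMetric hI hm hq hx, ricci_vbdsMetric hI hm hq hx, vbdsMetric_eq_add,
      hZ, hY, hX, ha, ← hk]
    field_simp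
    ring
  have h1 : ∀ i j, vbdsRadial lam m q x i j
      = vbdsMetric lam m q x i j - vbdsAngular x i j := fun i j => by
    rw [vbdsMetric_eq_add]
    ring
  have hu : ∀ i j, fluxScalar m q x * nullSquare x i j = ricci (vbdsMetric lam m q) x i j
      - a * vbdsMetric lam m q x i j - 2 * k * vbdsAngular x i j := fun i j => by
    rw [ricci_vbdsMetric hI hm hq hx, vbdsMetric_eq_add, ha, ← hk]
    ring
  have hKN : fluxScalar m q x / 2 * kulkarniNomizu vbdsAngular nullSquare x e f s t
      = 1 / 2 * kulkarniNomizu vbdsAngular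
        (fun x i j => fluxScalar m q x * nullSquare x i j) x e f s t := by
    simp only [kulkarniNomizu]
    ring
  rw [riemann_vbdsMetric_eq hI hm hq hx, hKN, ← hw, ← hk]
  simp only [kulkarniNomizu, hu, h1]
  have hl : lam = a + k := by rw [ha]; ring
  simp only [hH, hG, hE, hl]
  ring

end

/-! ### Scalar identities and smoothness of the coefficients -/

section

variable {lam : ℝ} {I : Set ℝ} {m q : ℝ → ℝ} {x : Pt 4}

/-- The curvature formulas hold on the whole chart, whose openness does not involve m or q. The
condition q² − rm ≠ 0 matters only for β and Π, which have rm − q² in their denominators. -/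
theorem vbdsRegion_subset_vbdsChart : vbdsRegion I m q ⊆ vbdsChart I := fun _ hx =>
  ⟨hx.1, hx.2.1.ne', (Real.sin_pos_of_pos_of_lt_pi hx.2.2.1 hx.2.2.2.1).ne'⟩

theorem vbdsBeta_mul_weylScalar (h1 : x 1 ≠ 0) (h : x 1 * m (x 0) - q (x 0) ^ 2 ≠ 0) :
    vbdsBeta lam m q x * weylScalar m q x = (2 * lam * weylScalar m q x + 3 * weylScalar m q x ^ 2
      - chargeScalar q x ^ 2) / 3 := by
  simp only [vbdsBeta, weylScalar, chargeScalar]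
  field_simp
  ring

/-- Here r³w = m − q²/r, and the given form is the logarithmic differential of this function;
multiplied by w it becomes dw + (3w/r) dr. -/
theorem vbdsForm_mul_weylScalar (hq : DifferentiableAt ℝ q (x 0)) (h1 : x 1 ≠ 0)
    (h : x 1 * m (x 0) - q (x 0) ^ 2 ≠ 0) (e : Fin 4) :
    vbdsForm m q x e * weylScalar m q x = ![weylScalarT m q (x 0) (x 1),
      weylScalarR m q (x 0) (x 1) + 3 * weylScalar m q x / x 1, 0, 0] e := by
  have hd : deriv (fun t => q t ^ 2) (x 0) = 2 * q (x 0) * deriv q (x 0) :=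
    (hq.hasDerivAt.pow 2).deriv.trans (by simp)
  have h' : x 1 ^ 2 * m (x 0) - x 1 * q (x 0) ^ 2 = x 1 * (x 1 * m (x 0) - q (x 0) ^ 2) := by ring
  revert e
  rw [forall_fin_four]
  refine ⟨?_, ?_, ?_, ?_⟩
  · simp only [vbdsForm, hd, Matrix.cons_val, weylScalar, weylScalarT]
    field_simp
  · simp only [vbdsForm, h', Matrix.cons_val, weylScalar, weylScalarR]
    field_simp
    ring
  · simp [vbdsForm]
  · simp [vbdsForm]

theorem contDiffOn_weylScalar (hm : ContDiffOn ℝ ∞ m I) (hq : ContDiffOn ℝ ∞ q I) :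
    ContDiffOn ℝ ∞ (weylScalar m q) (vbdsChart I) := by
  have h0 : Set.MapsTo (fun x : Pt 4 => x 0) (vbdsChart I) I := fun x hx => hx.1
  have p : ∀ i, ContDiffOn ℝ ∞ (fun x : Pt 4 => x i) (vbdsChart I) := fun i =>
    (contDiff_apply ℝ ℝ i).contDiffOn
  exact (((p 1).mul (hm.comp (p 0) h0)).sub ((hq.comp (p 0) h0).pow 2)).div ((p 1).pow 4)
    fun x hx => pow_ne_zero 4 hx.2.1

theorem contDiffOn_chargeScalar (hq : ContDiffOn ℝ ∞ q I) :
    ContDiffOn ℝ ∞ (chargeScalar q) (vbdsChart I) := by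
  have h0 : Set.MapsTo (fun x : Pt 4 => x 0) (vbdsChart I) I := fun x hx => hx.1
  have p : ∀ i, ContDiffOn ℝ ∞ (fun x : Pt 4 => x i) (vbdsChart I) := fun i =>
    (contDiff_apply ℝ ℝ i).contDiffOn
  exact ((hq.comp (p 0) h0).pow 2).div ((p 1).pow 4) fun x hx => pow_ne_zero 4 hx.2.1

theorem isGeneralizedRoterOn_vbdsMetric (hI : IsOpen I) (hm : ContDiffOn ℝ ∞ m I)
    (hq : ContDiffOn ℝ ∞ q I) {V : Set (Pt 4)} (hV : V ⊆ vbdsChart I)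
    (hV' : ∀ x ∈ V, q (x 0) ≠ 0) : IsGeneralizedRoterOn (vbdsMetric lam m q) V := by
  have hc : ∀ x ∈ V, chargeScalar q x ≠ 0 := fun x hx =>
    div_ne_zero (pow_ne_zero 2 (hV' x hx)) (pow_ne_zero 4 (hV hx).2.1)
  obtain ⟨w, hw⟩ : ∃ w, w = weylScalar m q := ⟨_, rfl⟩
  obtain ⟨k, hk⟩ : ∃ k, k = chargeScalar q := ⟨_, rfl⟩
  obtain ⟨a, ha⟩ : ∃ a : Pt 4 → ℝ, a = fun x => lam - k x := ⟨_, rfl⟩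
  obtain ⟨G, hG⟩ : ∃ G : Pt 4 → ℝ, G = fun x => -3 * w x + 3 * k x / 2 - lam / 2 := ⟨_, rfl⟩
  obtain ⟨E, hE⟩ : ∃ E : Pt 4 → ℝ, E = fun x => 3 * w x - k x := ⟨_, rfl⟩
  obtain ⟨X, hX⟩ : ∃ X : Pt 4 → ℝ, X = fun x => 1 / (4 * k x ^ 2) := ⟨_, rfl⟩
  obtain ⟨Y, hY⟩ : ∃ Y : Pt 4 → ℝ, Y = fun x => -2 * a x * X x := ⟨_, rfl⟩
  obtain ⟨Z, hZ⟩ : ∃ Z : Pt 4 → ℝ, Z = fun x => a x ^ 2 * X x := ⟨_, rfl⟩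
  have sw : ContDiffOn ℝ ∞ w V := hw ▸ (contDiffOn_weylScalar hm hq).mono hV
  have sk : ContDiffOn ℝ ∞ k V := hk ▸ (contDiffOn_chargeScalar hq).mono hV
  have sa : ContDiffOn ℝ ∞ a V := by rw [ha]; fun_prop
  have sG : ContDiffOn ℝ ∞ G V := by rw [hG]; fun_prop
  have sE : ContDiffOn ℝ ∞ E V := by rw [hE]; fun_prop
  have sX : ContDiffOn ℝ ∞ X V := by
    rw [hX]
    exact contDiffOn_const.div (contDiffOn_const.mul (sk.pow 2)) fun x hx =>
      mul_ne_zero four_ne_zero (pow_ne_zero 2 (hk ▸ hc x hx))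
  have sY : ContDiffOn ℝ ∞ Y V := by rw [hY]; fun_prop
  have sZ : ContDiffOn ℝ ∞ Z V := by rw [hZ]; fun_prop
  refine ⟨fun x => w x - k x / 2 + lam / 6 + G x * Z x + E x * Z x ^ 2,
    fun x => G x * Y x + 2 * E x * Y x * Z x + Z x / 2, fun x => E x * Y x ^ 2 + Y x / 2,
    fun x => G x * X x + 2 * E x * X x * Z x, fun x => 2 * E x * X x * Y x + X x / 2,
    fun x => E x * X x ^ 2, by fun_prop, by fun_prop, by fun_prop, by fun_prop, by fun_prop,
    by fun_prop, fun x hx e f s t => ?_⟩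
  exact riemann_roter hI (hm.differentiableOn (by simp)) (hq.differentiableOn (by simp)) (hV hx)
    (hc x hx) (congrFun hw x) (congrFun hk x) (congrFun ha x) (congrFun hG x) (congrFun hE x)
    (congrFun hX x) (congrFun hY x) (congrFun hZ x) e f s t

theorem isEinOn_vbdsMetric (hI : IsOpen I) (hm : ContDiffOn ℝ ∞ m I)
    (hq : ContDiffOn ℝ ∞ q I) {V : Set (Pt 4)} (hV : V ⊆ vbdsChart I) :
    IsEinOn (vbdsMetric lam m q) 3 V := by
  have sk : ContDiffOn ℝ ∞ (chargeScalar q) V := (contDiffOn_chargeScalar hq).mono hV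
  have hm' := hm.differentiableOn (by simp)
  have hq' := hq.differentiableOn (by simp)
  -- These are the coefficients of (X − a)²(X − b) with a = λ − e and b = λ + e. The polynomial is
  -- monic, so they have no common zero, and it annihilates the Ricci operator also where e = 0.
  refine ⟨![fun x => -((lam - chargeScalar q x) ^ 2 * (lam + chargeScalar q x)),
    fun x => (lam - chargeScalar q x) ^ 2
      + 2 * (lam - chargeScalar q x) * (lam + chargeScalar q x),
    fun x => -(2 * (lam - chargeScalar q x) + (lam + chargeScalar q x)), fun _ => 1], ?_,
    fun x hx => ⟨⟨3, by simp⟩, fun i j => ?_⟩⟩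
  · rw [forall_fin_four]
    simp only [Matrix.cons_val]
    exact ⟨by fun_prop, by fun_prop, by fun_prop, by fun_prop⟩
  · have h0 : ricciPow (vbdsMetric lam m q) 0 = vbdsMetric lam m q := by rw [ricciPow]
    have h1 : ricciPow (vbdsMetric lam m q) 1 = ricci (vbdsMetric lam m q) := by rw [ricciPow]
    have h2 := ricciPow_two_vbdsMetric (lam := lam) hI hm' hq' (hV hx) i j
    have h3 := ricciPow_three_vbdsMetric (lam := lam) hI hm' hq' (hV hx) i j
    rw [Fin.sum_univ_four]
    change _ * ricciPow _ 0 x i j + _ * ricciPow _ 1 x i j + _ * ricciPow _ 2 x i j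
      + _ * ricciPow _ 3 x i j = 0
    rw [h0, h1, h2, h3, ricci_vbdsMetric hI hm' hq' (hV hx), vbdsMetric_eq_add]
    simp only [Matrix.cons_val]
    ring

end

end SemiRiemannian

theorem mainTheorem1 (lam : ℝ) (I : Set ℝ) (hI : IsOpen I) (m q : ℝ → ℝ)
    (hm : ContDiffOn ℝ ∞ m I) (hq : ContDiffOn ℝ ∞ q I)
    (g : Cov2 4) (hg : g = vbdsMetric lam m q)
    (U : Set (Pt 4)) (hU : U = vbdsRegion I m q) :
    (∀ x ∈ U, ∀ a b c d r s : Fin 4,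
      curvDot g (weyl g) (weyl g) x a b c d r s
        = -((x 1 * m (x 0) - q (x 0) ^ 2) / x 1 ^ 4) * tachibana g (weyl g) x a b c d r s) ∧
    (∀ x ∈ U, ∀ a b c d r s : Fin 4,
      curvDot g (weyl g) (conharmonic g) x a b c d r s
        = -((x 1 * m (x 0) - q (x 0) ^ 2) / x 1 ^ 4)
          * tachibana g (conharmonic g) x a b c d r s) ∧
    (∀ x ∈ U, ∀ a b c d r s : Fin 4,
      curvDot g (conharmonic g) (weyl g) x a b c d r s
        = -((2 * x 1 ^ 4 * lam + 3 * x 1 * m (x 0) - 3 * q (x 0) ^ 2) / (3 * x 1 ^ 4))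
          * tachibana g (weyl g) x a b c d r s) ∧
    (∀ x ∈ U, ∀ a b c d r s : Fin 4,
      curvDot g (conharmonic g) (conharmonic g) x a b c d r s
        = -((2 * x 1 ^ 4 * lam + 3 * x 1 * m (x 0) - 3 * q (x 0) ^ 2) / (3 * x 1 ^ 4))
          * tachibana g (conharmonic g) x a b c d r s) ∧
    (∀ x ∈ U, ∀ a b c d r s : Fin 4,
      curvDot g (riemann g) (riemann g) x a b c d r s
          + vbdsBeta lam m q x * tachibana g (weyl g) x a b c d r s
        = tachibana (ricci g) (riemann g) x a b c d r s) ∧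
    TwoFormsRecurrentOn g (weyl g) (vbdsForm m q) U ∧
    IsGeneralizedRoterOn g {x ∈ U | q (x 0) ≠ 0} ∧
    IsEinOn g 3 U ∧
    RicciCompatibleOn g (riemann g) U ∧
    RicciCompatibleOn g (projective g) U ∧
    RicciCompatibleOn g (concircular g) U ∧
    RicciCompatibleOn g (conharmonic g) U ∧
    RicciCompatibleOn g (weyl g) U := by
  subst hg hU
  have hm' : DifferentiableOn ℝ m I := hm.differentiableOn (by simp)
  have hq' : DifferentiableOn ℝ q I := hq.differentiableOn (by simp)
  have hsub : vbdsRegion I m q ⊆ vbdsChart I := vbdsRegion_subset_vbdsChart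
  have hne : ∀ x ∈ vbdsRegion I m q, x 1 * m (x 0) - q (x 0) ^ 2 ≠ 0 := fun x hx h =>
    hx.2.2.2.2 (by linarith)
  have hcoef : ∀ x ∈ vbdsRegion I m q, 2 * lam / 3 + weylScalar m q x
      = (2 * x 1 ^ 4 * lam + 3 * x 1 * m (x 0) - 3 * q (x 0) ^ 2) / (3 * x 1 ^ 4) := fun x hx => by
    have := (hsub hx).2.1
    rw [weylScalar]
    field_simp
    ring
  -- Because the scalar curvature is the constant 4λ, each of the five tensors is R plus constant
  -- multiples of g∧g, g∧S and the projective correction.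
  have hcompat : ∀ (α β γ : ℝ) (W : Cov4 4), (∀ x ∈ vbdsRegion I m q, ∀ b c d f, W x b c d f
      = riemann (vbdsMetric lam m q) x b c d f
        + α * kulkarniNomizu (vbdsMetric lam m q) (vbdsMetric lam m q) x b c d f
        + β * kulkarniNomizu (vbdsMetric lam m q) (ricci (vbdsMetric lam m q)) x b c d f
        + γ * (vbdsMetric lam m q x b f * ricci (vbdsMetric lam m q) x c d
          - vbdsMetric lam m q x c f * ricci (vbdsMetric lam m q) x b d)) →
      RicciCompatibleOn (vbdsMetric lam m q) W (vbdsRegion I m q) := fun α β γ W hW x hx =>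
    ricciCompatible_add (isUnit_det_vbdsMetric lam m q (hsub hx).2.1 (hsub hx).2.2)
      (vbdsMetric_symm lam m q x) (ricci_vbdsMetric_symm hI hm' hq' (hsub hx))
      (ricciCompatible_riemann hI hm' hq' (hsub hx)) α β γ (hW x hx)
  refine ⟨fun x hx a b c d r s => ?_, fun x hx a b c d r s => ?_, fun x hx a b c d r s => ?_,
    fun x hx a b c d r s => ?_, fun x hx => ?_, fun x hx => ?_, ?_, ?_, ?_, ?_, ?_, ?_, ?_⟩
  · exact curvDot_weyl_twoBlock hI hm' hq' (hsub hx) _ _ _ _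
      (weyl_eq_twoBlock hI hm' hq' (hsub hx)) a b c d r s
  · exact curvDot_weyl_twoBlock hI hm' hq' (hsub hx) _ _ _ _
      (conharmonic_eq_twoBlock hI hm' hq' (hsub hx)) a b c d r s
  · rw [← hcoef x hx]
    exact curvDot_conharmonic_twoBlock hI hm' hq' (hsub hx) _ _ _ _
      (weyl_eq_twoBlock hI hm' hq' (hsub hx)) a b c d r s
  · rw [← hcoef x hx]
    exact curvDot_conharmonic_twoBlock hI hm' hq' (hsub hx) _ _ _ _
      (conharmonic_eq_twoBlock hI hm' hq' (hsub hx)) a b c d r s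
  · exact curvDot_riemann_riemann hI hm' hq' (hsub hx) _
      (vbdsBeta_mul_weylScalar (hsub hx).2.1 (hne x hx))
  · exact recurrent_weyl hI hm' hq' (hsub hx)
      (vbdsForm_mul_weylScalar (hq'.differentiableAt (hI.mem_nhds hx.1)) (hsub hx).2.1 (hne x hx))
  · exact isGeneralizedRoterOn_vbdsMetric hI hm hq (fun x hx => hsub hx.1) fun x hx => hx.2
  · exact isEinOn_vbdsMetric hI hm hq hsub
  · exact hcompat 0 0 0 _ fun x hx b c d f => by ring
  · refine hcompat 0 0 (-(1 / 3)) _ fun x hx b c d f => ?_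
    simp only [projective]
    push_cast
    ring
  · refine hcompat (-(lam / 6)) 0 0 _ fun x hx b c d f => ?_
    simp only [concircular, scalarCurv_vbdsMetric hI hm' hq' (hsub hx)]
    push_cast
    ring
  · refine hcompat 0 (-(1 / 2)) 0 _ fun x hx b c d f => ?_
    simp only [conharmonic]
    push_cast
    ring
  · refine hcompat (lam / 3) (-(1 / 2)) 0 _ fun x hx b c d f => ?_
    simp only [weyl, scalarCurv_vbdsMetric hI hm' hq' (hsub hx)]
    push_cast
    ring
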